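/- Let $(R,\mathfrak m)$ be a complete regular local ring of prime characteristic $p$, with residue field $\mathbb K=R/\mathfrak m$, and let $E=E_R(R/\mathfrak m)$ be an injective hull of the residue field. For an $R$-module $M$ let ${}^fM$ denote the abelian group $M$ with the $R$-module structure $r\cdot a=r^pa$. Let ${}^fR$ also denote the ring $R$ viewed as an $R$-algebra through the Frobenius map; then ${}^fM$ is an ${}^fR$-module through the original action, and $\operatorname{Hom}_R({}^fR,M)$ is an ${}^fR$-module through $(s\varphi)(x)=\varphi(sx)$. (a) The ${}^fR$-module $\operatorname{Hom}_R({}^fR,E)$ is injective, and there is an isomorphism of ${}^fR$-modules $$D:\operatorname{Hom}_R({}^fR,E)\;\cong\;\bigoplus_{\gamma\in\Gamma}{}^fE\;\oplus\;H,\qquad H=\bigoplus_{\lambda\in\Lambda}{}^fE(R/P_\lambda),$$ where $\Gamma$ is non-empty, $\Lambda$ is a (possibly empty) set, and $E(R/P_\lambda)$ is an injective hull of $R/P_\lambda$ for a non-maximal prime ideal $P_\lambda$ of $R$. In every such decomposition $\Gamma$ is non-empty. Moreover, for every such decomposition $D$: (b) Let $\mathcal B=\operatorname{Hom}_R(E,\bigoplus_{\gamma\in\Gamma}{}^fE)$,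 an ${}^fR$-module through the action on the target. There is an isomorphism of ${}^fR$-modules $\Psi:\operatorname{Hom}_R({}^fR,R)\cong\mathcal B$ such that $D\bigl(s\mapsto\varphi(s)a\bigr)=(\Psi(\varphi)(a),0)$ for all $\varphi\in\operatorname{Hom}_R({}^fR,R)$ and $a\in E$. The ${}^fR$-linear map $\mathcal B\to\prod_{\gamma\in\Gamma}\operatorname{Hom}_R(E,{}^fE)$, $h\mapsto(\pi_\gamma\circ h)_\gamma$, with $\pi_\gamma$ the projection to the component $\gamma$, is injective. Let $x_1,\dots,x_d$ be any minimal generators of $\mathfrak m$. Then $E$ is isomorphic as an $R$-module to the module of inverse polynomials $$R_{x_1\cdots x_d}\Big/\sum_{i=1}^d R_{x_1\cdots\widehat{x_i}\cdots x_d},$$ and for every such isomorphism, if $T\in\operatorname{Hom}_R(E,{}^fE)$ is the standard Frobenius map on $E$, which under this isomorphism sends the class of a fraction $u$ to the class of $u^p$ (so $T(r\,x_1^{-\alpha_1}\cdots x_d^{-\alpha_d})=r^p\,x_1^{-p\alpha_1}\cdots x_d^{-p\alpha_d}$), the map $(r_\gamma)_\gamma\mapsto(r_\gamma T)_\gamma$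 is an isomorphism of ${}^fR$-modules $$\prod_{\gamma\in\Gamma}{}^fR\;\cong\;\prod_{\gamma\in\Gamma}\operatorname{Hom}_R(E,{}^fE).$$ (c) The set $\Gamma$ is finite if and only if ${}^f\mathbb K$ is a finite extension of $\mathbb K$ (that is, $\mathbb K$ is finite over $\mathbb K^p$), in which case $\#\Gamma=1$. -/

import Mathlib

open IsLocalRing
open scoped DirectSum

universe u

noncomputable section

/-- The ring `ᶠR`: a copy of `R`, regarded as an `R`-algebra through the Frobenius map, so that
`r • s = r ^ p * s`. -/
def FrobRing (_p : ℕ) (R : Type*) : Type _ := R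

/-- The module `ᶠM`: a copy of the `R`-module `M`, regarded as a module over the ring `ᶠR` through
the original action, and as an `R`-module through `r • a = r ^ p a`. -/
def FrobMod (_p : ℕ) (M : Type*) : Type _ := M

section Frob

variable (p : ℕ) {R : Type*} [CommRing R] {M N : Type*} [AddCommGroup M] [AddCommGroup N]

instance : CommRing (FrobRing p R) := inferInstanceAs (CommRing R)

instance : AddCommGroup (FrobMod p M) := inferInstanceAs (AddCommGroup M)

/-- The identity map `R → ᶠR`, an isomorphism of rings. -/
def toFrobRing : R ≃+* FrobRing p R := RingEquiv.refl R

/-- The identity map `M → ᶠM`, an isomorphism of additive groups. -/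
def toFrobMod : M ≃+ FrobMod p M := AddEquiv.refl M

variable [Module R M] [Module R N]

/-- `ᶠM` is an `ᶠR`-module through the original action of `R` on `M`. -/
instance : Module (FrobRing p R) (FrobMod p M) :=
  inferInstanceAs (Module R M)

lemma toFrobRing_smul_toFrobMod (r : R) (a : M) :
    toFrobRing p r • toFrobMod p a = toFrobMod p (r • a) := rfl

variable [ExpChar R p]

/-- `ᶠR` is an `R`-algebra through the Frobenius map. -/
instance : Algebra R (FrobRing p R) :=
  ((toFrobRing p : R ≃+* FrobRing p R).toRingHom.comp (frobenius R p)).toAlgebra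

lemma algebraMap_frobRing (r : R) : algebraMap R (FrobRing p R) r = toFrobRing p (r ^ p) := rfl

/-- `ᶠM` is an `R`-module through `r • a = r ^ p a`. -/
instance : Module R (FrobMod p M) := Module.compHom _ (algebraMap R (FrobRing p R))

lemma smul_toFrobMod (r : R) (a : M) : r • toFrobMod p a = toFrobMod p (r ^ p • a) := rfl

instance : IsScalarTower R (FrobRing p R) (FrobMod p M) :=
  IsScalarTower.of_algebraMap_smul fun _ _ => rfl

end Frob

section Hom

variable (p : ℕ) (R : Type*) [CommRing R] [ExpChar R p]

/-- `Hom_R(ᶠR, M)`. -/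
def FrobHom (M : Type*) [AddCommGroup M] [Module R M] : Type _ := FrobRing p R →ₗ[R] M

variable {R} {M N : Type*} [AddCommGroup M] [Module R M] [AddCommGroup N] [Module R N]

instance : AddCommGroup (FrobHom p R M) := inferInstanceAs (AddCommGroup (FrobRing p R →ₗ[R] M))

instance : FunLike (FrobHom p R M) (FrobRing p R) M :=
  inferInstanceAs (FunLike (FrobRing p R →ₗ[R] M) (FrobRing p R) M)

/-- `ᶠR` acts on `Hom_R(ᶠR, M)` by `(s • φ) x = φ (s * x)`. -/
instance : Module (FrobRing p R) (FrobHom p R M) where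
  smul s φ := LinearMap.comp (φ : FrobRing p R →ₗ[R] M) (LinearMap.mulLeft R s)
  one_smul φ := LinearMap.ext fun x => congrArg φ (one_mul x)
  mul_smul s t φ := LinearMap.ext fun x =>
    congrArg φ (show s * t * x = t * (s * x) by ring)
  smul_zero s := LinearMap.zero_comp _
  smul_add s φ ψ := LinearMap.add_comp _ _ _
  add_smul s t φ := LinearMap.ext fun x =>
    (congrArg φ (add_mul s t x)).trans (map_add (show FrobRing p R →ₗ[R] M from φ) _ _)
  zero_smul φ := LinearMap.ext fun x =>
    (congrArg φ (zero_mul x)).trans (map_zero (show FrobRing p R →ₗ[R] M from φ))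

lemma FrobHom.smul_apply (s : FrobRing p R) (φ : FrobHom p R M) (x : FrobRing p R) :
    (s • φ) x = φ (s * x) := rfl

/-- Composition with an `R`-linear map `g : M → N`, as a map `Hom_R(ᶠR, M) → Hom_R(ᶠR, N)`. -/
def FrobHom.map (g : M →ₗ[R] N) : FrobHom p R M →ₗ[FrobRing p R] FrobHom p R N where
  toFun φ := LinearMap.comp g (φ : FrobRing p R →ₗ[R] M)
  map_add' _ _ := LinearMap.comp_add _ _ _
  map_smul' _ _ := rfl

lemma FrobHom.map_apply (g : M →ₗ[R] N) (φ : FrobHom p R M) (x : FrobRing p R) :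
    FrobHom.map p g φ x = g (φ x) := rfl

end Hom

/-- `E` is an injective hull of the `R`-module `M`: it is injective and it contains a copy of `M`
which meets every nonzero submodule of `E`. -/
def IsInjectiveHull (R : Type u) [CommRing R] (M E : Type u) [AddCommGroup M] [Module R M]
    [AddCommGroup E] [Module R E] : Prop :=
  Module.Injective R E ∧ ∃ i : M →ₗ[R] E, Function.Injective i ∧
    ∀ N : Submodule R E, N ⊓ LinearMap.range i = ⊥ → N = ⊥

section Inverse

lemma add_pow_of_expChar (R : Type*) {S : Type*} [CommRing R] [CommRing S] [Algebra R S] (p : ℕ)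
    [hp : ExpChar R p] (a b : S) : (a + b) ^ p = a ^ p + b ^ p := by
  cases hp with
  | zero => simp only [pow_one]
  | prime hq =>
    obtain ⟨c, hc⟩ := exists_add_pow_prime_eq hq a b
    have h0 : (p : S) = 0 := by
      rw [← map_natCast (algebraMap R S), CharP.cast_eq_zero, map_zero]
    rw [hc, h0, zero_mul, zero_mul, zero_mul, add_zero]

variable {R : Type*} [CommRing R] {d : ℕ}

/-- The submodule `∑ i, R[1 / (x₁ ⋯ x̂ᵢ ⋯ x_d)]` of `R[1 / (x₁ ⋯ x_d)]`. -/
def InversePolynomials.relations (x : Fin d → R) :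
    Submodule R (Localization.Away (∏ i, x i)) :=
  Submodule.span R {a | ∃ (i : Fin d) (k : ℕ) (r : R),
    (∏ j ∈ Finset.univ.erase i, x j) ^ k • a = algebraMap R _ r}

/-- The module of inverse polynomials in `x₁, …, x_d`, that is
`R[1 / (x₁ ⋯ x_d)] / ∑ i, R[1 / (x₁ ⋯ x̂ᵢ ⋯ x_d)]`. It is generated by the classes of the inverse
monomials `x₁ ^ (-α₁) ⋯ x_d ^ (-α_d)` with all `αᵢ > 0`, since those of the other monomials vanish;
if `R` is the power series ring `K⟦x₁, …, x_d⟧` then they form a `K`-basis. -/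
def InversePolynomials (x : Fin d → R) : Type _ :=
  Localization.Away (∏ i, x i) ⧸ InversePolynomials.relations x

namespace InversePolynomials

instance (x : Fin d → R) : AddCommGroup (InversePolynomials x) :=
  inferInstanceAs (AddCommGroup (_ ⧸ relations x))

instance (x : Fin d → R) : Module R (InversePolynomials x) :=
  inferInstanceAs (Module R (_ ⧸ relations x))

/-- The class of a fraction. -/
def mk (x : Fin d → R) : Localization.Away (∏ i, x i) →ₗ[R] InversePolynomials x :=
  (relations x).mkQ

/-- The inverse monomial `x₁ ^ (-α₁) ⋯ x_d ^ (-α_d)`; each `xᵢ` is a unit of `R[1 / (x₁ ⋯ x_d)]`. -/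
def monomial (x : Fin d → R) (α : Fin d → ℕ) : InversePolynomials x :=
  mk x (∏ i, Ring.inverse (algebraMap R _ (x i)) ^ α i)

variable (p : ℕ) [ExpChar R p]

/-- The standard Frobenius map on the module of inverse polynomials, induced by the `p`-th power
map on fractions. It is additive with `T (r a) = r ^ p T a`, that is, an `R`-linear map to the
Frobenius twist. -/
def T (x : Fin d → R) : InversePolynomials x →ₗ[R] FrobMod p (InversePolynomials x) :=
  (relations x).liftQ
    { toFun := fun a => toFrobMod p (mk x (a ^ p))
      map_add' := fun a b => by rw [add_pow_of_expChar R p, map_add, map_add]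
      map_smul' := fun r a => by rw [smul_pow, map_smul, RingHom.id_apply, smul_toFrobMod] }
    (by
      refine Submodule.span_le.2 ?_
      rintro a ⟨i, k, r, h⟩
      change toFrobMod p (mk x (a ^ p)) = 0
      have hm : a ^ p ∈ relations x := by
        refine Submodule.subset_span ⟨i, k * p, r ^ p, ?_⟩
        rw [map_pow, ← h, smul_pow, pow_mul]
      rw [show mk x (a ^ p) = 0 from (Submodule.Quotient.mk_eq_zero _).2 hm, map_zero])

lemma T_mk (x : Fin d → R) (a : Localization.Away (∏ i, x i)) :
    T p x (mk x a) = toFrobMod p (mk x (a ^ p)) := rfl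

lemma T_smul_monomial (x : Fin d → R) (r : R) (α : Fin d → ℕ) :
    T p x (r • monomial x α) = toFrobMod p (r ^ p • monomial x fun i => p * α i) := by
  rw [monomial, map_smul, T_mk, smul_toFrobMod, monomial, ← Finset.prod_pow]
  simp_rw [← pow_mul, mul_comm]

/-- The standard Frobenius map on an `R`-module `E` which is identified with the module of inverse
polynomials through `θ`. -/
def frobenius {E : Type*} [AddCommGroup E] [Module R E] (x : Fin d → R)
    (θ : E ≃ₗ[R] InversePolynomials x) : E →ₗ[R] FrobMod p E where
  toFun a := toFrobMod p (θ.symm ((toFrobMod p).symm (T p x (θ a))))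
  map_add' a b := by simp only [map_add]
  map_smul' r a := by
    rw [map_smul θ, map_smul (T p x)]
    exact congrArg (toFrobMod p) (map_smul θ.symm (r ^ p) ((toFrobMod p).symm (T p x (θ a))))

end InversePolynomials

end Inverse

/-- The residue field of a local ring of characteristic `p` has characteristic `p`. -/
instance instExpCharResidueField (R : Type*) [CommRing R] [IsLocalRing R] (p : ℕ)
    [hp : Fact p.Prime] [CharP R p] : ExpChar (ResidueField R) p :=
  have : CharP (ResidueField R) p := (CharP.charP_iff_prime_eq_zero hp.out).2 (by
    rw [← map_natCast (residue R), CharP.cast_eq_zero, map_zero])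
  ExpChar.prime hp.out

section Components

variable (p : ℕ) (R : Type*) [CommRing R] [ExpChar R p] (E : Type*) [AddCommGroup E] [Module R E]
  (Γ : Type*)

/-- The inclusion `Hom_R(E, ⨁_γ ᶠE) → ∏_γ Hom_R(E, ᶠE)`, `h ↦ (π_γ ∘ h)_γ`. -/
def homComponents :
    (E →ₗ[R] ⨁ _ : Γ, FrobMod p E) →ₗ[FrobRing p R] (Γ → (E →ₗ[R] FrobMod p E)) where
  toFun h γ := DirectSum.component R Γ (fun _ => FrobMod p E) γ ∘ₗ h
  map_add' _ _ := rfl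
  map_smul' _ _ := rfl

end Components

end

/-! ### Regular local rings: quotients by parameters, and integrality. -/

section Regular

/-! Everything rests on a concrete model of `E`. Quotients of a regular local ring by some of a
minimal set of generators of `𝔪` are again regular, hence domains, so the generators `x i` form a
regular sequence in every order (`IsRegularLocalRing.isPermutableRegular`). Ideal arithmetic with
their powers then shows that `(x₁ ⋯ x_d)⁻ⁿ` has annihilator `(x₁ⁿ, …, x_dⁿ)`, and that its multiples
are exactly the inverse polynomials killed by all `xᵢⁿ`. Hence the inverse polynomials are an
essential extension of the residue field; they embed in `E`, and a length count makes the embedding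
onto (`InversePolynomials.nonempty_linearEquiv`). A `q`-semilinear endomorphism must send `(x₁ ⋯
x_d)⁻ⁿ` to a multiple of its `q`-th power, and by completeness these multipliers converge to a
single element of `R` (`InversePolynomials.existsUnique_eq_smul`). With `q = 1` this says `End(E) =
R`; with `q = p` it says that `Hom(E, ᶠE)` is free on `T`.

For (a), coinduction preserves injectivity, and Matlis' structure theorem decomposes the coinduced
module. For (b), the maps `s ↦ φ(s) a` are killed by a power of `𝔪`, whereas the hull of `R/P` with
`P` non-maximal has no nonzero such element, so `D` sends them into the copies of `ᶠE`; that every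
`h` arises from some `φ` is `End(E) = R` (`FrobHom.exists_linearEquiv_hom`).

For (c), and for `Γ` being non-empty, compare socles: the socle of `Hom(ᶠR, E)` is `Hom(ᶠ𝕂, 𝕂)`, so
`#Γ` is its `ᶠ𝕂`-dimension (`FrobHom.nonempty_basis`). By the tower law, `[ᶠ𝕂 : 𝕂] · #Γ` is the
dimension of the `𝕂`-dual of `ᶠ𝕂`. A finite-dimensional space has the dimension of its dual, which
forces `#Γ = 1`; an infinite-dimensional one has strictly smaller dimension, which forces `Γ`
infinite. -/

lemma IsLocalRing.quotient_of_le_maximalIdeal {R : Type*} [CommRing R] [IsLocalRing R]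
    {I : Ideal R} (hI : I ≤ maximalIdeal R) : IsLocalRing (R ⧸ I) :=
  have : Nontrivial (R ⧸ I) :=
    Ideal.Quotient.nontrivial_iff.2 fun h => (maximalIdeal.isMaximal R).ne_top (top_le_iff.1 (h ▸ hI))
  IsLocalRing.of_surjective' _ Ideal.Quotient.mk_surjective

lemma IsLocalRing.exists_natCast_eq_ringKrullDim (R : Type*) [CommRing R] [IsLocalRing R]
    [IsNoetherianRing R] : ∃ n : ℕ, ringKrullDim R = n := by
  have h1 := ringKrullDim_lt_top (R := R)
  have h0 := ringKrullDim_nonneg_of_nontrivial (R := R)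
  generalize ringKrullDim R = a at h0 h1
  induction a using WithBot.recBotCoe with
  | bot => simp at h0
  | coe a =>
    induction a using ENat.recTopCoe with
    | top => simp at h1
    | coe n => exact ⟨n, rfl⟩

/-- Dividing a regular local ring by part of a minimal system of generators of its maximal ideal
gives a regular local ring of the expected dimension. -/
theorem IsRegularLocalRing.quotient_span {R : Type*} [CommRing R] [IsRegularLocalRing R]
    (s t : Finset R) (h : Ideal.span (s ∪ t : Set R) = maximalIdeal R)
    (hcard : s.card + t.card ≤ (maximalIdeal R).spanFinrank) :
    ∃ _ : IsRegularLocalRing (R ⧸ Ideal.span (s : Set R)),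
      (maximalIdeal (R ⧸ Ideal.span (s : Set R))).spanFinrank = t.card := by
  have hs : (s : Set R) ⊆ maximalIdeal R := by
    rw [← h]; exact Set.subset_union_left.trans Ideal.subset_span
  have hI : Ideal.span (s : Set R) ≤ maximalIdeal R := Ideal.span_le.2 hs
  have hloc := IsLocalRing.quotient_of_le_maximalIdeal hI
  have hmax : maximalIdeal (R ⧸ Ideal.span (s : Set R)) =
      Ideal.span (Ideal.Quotient.mk (Ideal.span (s : Set R)) '' t) := by
    rw [← map_maximalIdeal_of_surjective (Ideal.Quotient.mk (Ideal.span (s : Set R)))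
      Ideal.Quotient.mk_surjective, ← h, Ideal.span_union, Ideal.map_sup, Ideal.map_quotient_self,
      bot_sup_eq, Ideal.map_span]
  have h1 : (maximalIdeal (R ⧸ Ideal.span (s : Set R))).spanFinrank ≤ t.card := by
    rw [hmax]
    refine (Submodule.spanFinrank_span_le_ncard_of_finite (t.finite_toSet.image _)).trans ?_
    exact (Set.ncard_image_le t.finite_toSet).trans (Set.ncard_coe_finset t).le
  -- Killing `s` lowers the dimension by at most `s.card`, so `t.card ≤ dim ≤ spanFinrank ≤ t.card`
  -- in the quotient, with equality throughout.
  have h2 := ringKrullDim_le_ringKrullDim_quotient_add_card s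
    (by rw [IsLocalRing.ringJacobson_eq_maximalIdeal]; exact hs)
  have h3 := ringKrullDim_le_spanFinrank_maximalIdeal (R ⧸ Ideal.span (s : Set R))
  rw [← IsRegularLocalRing.spanFinrank_maximalIdeal] at h2
  obtain ⟨n, hn⟩ := IsLocalRing.exists_natCast_eq_ringKrullDim (R ⧸ Ideal.span (s : Set R))
  rw [hn] at h2 h3
  have h2' : (maximalIdeal R).spanFinrank ≤ n + s.card := by exact_mod_cast h2
  have h3' : n ≤ (maximalIdeal (R ⧸ Ideal.span (s : Set R))).spanFinrank := by exact_mod_cast h3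
  refine ⟨(isRegularLocalRing_iff _).2 ?_, by omega⟩
  rw [hn]
  exact_mod_cast (show _ = n by omega)

/-- Exchange argument: if no coefficient of `a` in the generators were a unit, `a` would lie in
`𝔪²`; the generator with a unit coefficient can be traded for `a`. -/
lemma IsLocalRing.exists_span_insert_erase {R : Type*} [CommRing R] [IsLocalRing R] [DecidableEq R]
    {g : Finset R} (hg : Ideal.span (g : Set R) = maximalIdeal R) {a : R} (ha : a ∈ maximalIdeal R)
    (ha2 : a ∉ maximalIdeal R ^ 2) :
    ∃ b ∈ g, Ideal.span (({a} : Finset R) ∪ (g.erase b : Finset R) : Set R) = maximalIdeal R := by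
  obtain ⟨c, hc⟩ := Submodule.mem_span_finset'.1 (show a ∈ Submodule.span R (g : Set R) from
    hg.ge ha)
  have hgm : ∀ b ∈ g, b ∈ maximalIdeal R := fun b hb => hg ▸ Ideal.subset_span hb
  obtain ⟨b, hb⟩ : ∃ b : g, IsUnit (c b) := by
    by_contra! hu
    refine ha2 (hc ▸ Ideal.sum_mem _ fun b _ => ?_)
    rw [pow_two, smul_eq_mul]
    exact Ideal.mul_mem_mul ((mem_maximalIdeal _).2 (hu b)) (hgm b b.2)
  refine ⟨b, b.2, le_antisymm (Ideal.span_le.2 ?_) (hg ▸ Ideal.span_le.2 fun y hy => ?_)⟩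
  · rintro y (hy | hy)
    · rw [Finset.mem_coe, Finset.mem_singleton] at hy
      exact hy ▸ ha
    · exact hgm y (Finset.mem_of_mem_erase hy)
  · have herase : ∀ y ∈ g, y ≠ b → y ∈ Ideal.span
        (({a} : Finset R) ∪ (g.erase b : Finset R) : Set R) := fun y hy hyb =>
      Ideal.subset_span (Or.inr (Finset.mem_erase.2 ⟨hyb, hy⟩))
    by_cases hyb : y = b
    · subst hyb
      have hmem : c b * (b : R) ∈ Ideal.span
          (({a} : Finset R) ∪ (g.erase b : Finset R) : Set R) := by
        rw [← Finset.add_sum_erase _ _ (Finset.mem_univ b), smul_eq_mul] at hc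
        rw [← eq_sub_iff_add_eq] at hc
        rw [hc]
        refine Ideal.sub_mem _ (Ideal.subset_span (Or.inl (by simp))) (Ideal.sum_mem _ fun y hy => ?_)
        exact Ideal.mul_mem_left _ _ (herase y y.2
          fun h => (Finset.mem_erase.1 hy).1 (Subtype.ext h))
      exact (Ideal.unit_mul_mem_iff_mem _ hb).1 hmem
    · exact herase y hy hyb

/-- Induction on the number of generators of `𝔪`. Choose `a ∈ 𝔪` outside `𝔪²` and all minimal
primes. Then `R/(a)` is regular of smaller dimension, so `(a)` is prime and contains a minimal prime
`P`; as `a ∉ P`, `P = aP`, and Nakayama gives `P = 0`. -/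
theorem IsRegularLocalRing.isDomain (R : Type*) [CommRing R] [IsRegularLocalRing R] :
    IsDomain R := by
  classical
  generalize hn : (maximalIdeal R).spanFinrank = n
  induction n generalizing R with
  | zero =>
    have h0 : maximalIdeal R = ⊥ :=
      (Submodule.spanFinrank_eq_zero_iff_eq_bot (maximalIdeal R).fg_of_isNoetherianRing).1 hn
    exact (IsLocalRing.isField_iff_maximalIdeal_eq.2 h0).isDomain
  | succ n ih =>
    have hne : maximalIdeal R ≠ ⊥ := fun h => by
      rw [h, Submodule.spanFinrank_bot] at hn; omega
    obtain ⟨a, ha, ha2, hamin⟩ : ∃ a ∈ maximalIdeal R, a ∉ maximalIdeal R ^ 2 ∧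
        ∀ P ∈ minimalPrimes R, a ∉ P := by
      by_contra! hcon
      have hfin := minimalPrimes.finite_of_isNoetherianRing R
      have hsub : (maximalIdeal R : Set R) ⊆ ⋃ I ∈ ((insert (maximalIdeal R ^ 2) hfin.toFinset :
          Finset (Ideal R)) : Set (Ideal R)), (I : Set R) := fun a ha => by
        by_cases h2 : a ∈ maximalIdeal R ^ 2
        · exact Set.mem_biUnion (by simp) h2
        · obtain ⟨P, hP, haP⟩ := hcon a ha h2
          exact Set.mem_biUnion (by simp [hP]) haP
      -- Prime avoidance tolerates two non-prime ideals; `𝔪²` occupies both slots.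
      replace hsub := (Ideal.subset_union_prime (f := id) (maximalIdeal R ^ 2)
        (maximalIdeal R ^ 2) ?_).1 hsub
      · obtain ⟨I, hI, hle⟩ := hsub
        rw [Finset.mem_insert, Set.Finite.mem_toFinset] at hI
        rcases hI with rfl | hI
        · refine hne (Submodule.eq_bot_of_le_smul_of_le_jacobson_bot (maximalIdeal R) _
            (maximalIdeal R).fg_of_isNoetherianRing ?_ (IsLocalRing.maximalIdeal_le_jacobson _))
          rw [smul_eq_mul, ← pow_two]; exact hle
        · have hp : I.IsPrime := hI.1.1
          have : I = maximalIdeal R := le_antisymm (le_maximalIdeal hp.ne_top) hle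
          have h0 : (maximalIdeal R).height = 0 := by
            rw [← this, Ideal.height_eq_zero_iff]
            exact hI
          have h1 := IsLocalRing.maximalIdeal_height_eq_ringKrullDim (R := R)
          rw [h0, ← IsRegularLocalRing.spanFinrank_maximalIdeal, hn] at h1
          have : (0 : ℕ) = n + 1 := by exact_mod_cast h1
          omega
      · intro I hI h1 _
        rw [Finset.mem_insert, Set.Finite.mem_toFinset] at hI
        exact (hI.resolve_left h1).1.1
    obtain ⟨g, hg, hgs⟩ := Submodule.FG.exists_span_finset_card_eq_spanFinrank
      (maximalIdeal R).fg_of_isNoetherianRing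
    obtain ⟨b, hb, hspan⟩ := IsLocalRing.exists_span_insert_erase hgs ha ha2
    obtain ⟨h1, h2⟩ := IsRegularLocalRing.quotient_span _ _ hspan (by
      rw [Finset.card_singleton, Finset.card_erase_of_mem hb, hg, hn]; omega)
    have hdom := ih (R ⧸ Ideal.span (({a} : Finset R) : Set R)) (by
      rw [h2, Finset.card_erase_of_mem hb, hg, hn]; omega)
    rw [Ideal.Quotient.isDomain_iff_prime, Finset.coe_singleton] at hdom
    obtain ⟨P, hP, hPa⟩ := Ideal.exists_minimalPrimes_le (bot_le : ⊥ ≤ Ideal.span {a})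
    have hPp : P.IsPrime := hP.1.1
    have hPbot : P = ⊥ := by
      refine Submodule.eq_bot_of_le_smul_of_le_jacobson_bot (maximalIdeal R) P
        P.fg_of_isNoetherianRing (fun y hy => ?_) (IsLocalRing.maximalIdeal_le_jacobson _)
      obtain ⟨z, rfl⟩ := Ideal.mem_span_singleton'.1 (hPa hy)
      rw [mul_comm]
      exact Submodule.smul_mem_smul ha ((hPp.mem_or_mem hy).resolve_right (hamin P hP))
    subst hPbot
    exact IsDomain.of_bot_isPrime R

end Regular

/-! ### Arithmetic of ideals generated by powers of a permutable regular sequence. -/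

section PermutableRegular

variable {R : Type*} [CommRing R] {ι : Type*}

/-- Every `x i` is a nonzerodivisor modulo each ideal generated by some of the other `x j`. -/
noncomputable def IsPermutableRegular (x : ι → R) : Prop :=
  ∀ (s : Finset ι) (i : ι), i ∉ s → ∀ r : R,
    x i * r ∈ Ideal.span (x '' s) → r ∈ Ideal.span (x '' s)

/-- The ideal generated by the powers `x i ^ a i` with `i ∈ s`. -/
noncomputable def powIdeal (x : ι → R) (a : ι → ℕ) (s : Set ι) : Ideal R :=
  Ideal.span ((fun i => x i ^ a i) '' s)

lemma pow_mem_powIdeal (x : ι → R) {a : ι → ℕ} {s : Set ι} {i : ι} (hi : i ∈ s) {n : ℕ}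
    (hn : a i ≤ n) : x i ^ n ∈ powIdeal x a s :=
  (powIdeal x a s).pow_mem_of_pow_mem (Ideal.subset_span ⟨i, hi, rfl⟩) hn

lemma powIdeal_mono (x : ι → R) {a b : ι → ℕ} {s : Set ι} (h : ∀ i ∈ s, a i ≤ b i) :
    powIdeal x b s ≤ powIdeal x a s := by
  refine Ideal.span_le.2 ?_
  rintro _ ⟨i, hi, rfl⟩
  exact pow_mem_powIdeal x hi (h i hi)

lemma powIdeal_congr (x : ι → R) {a b : ι → ℕ} {s : Set ι} (h : ∀ i ∈ s, a i = b i) :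
    powIdeal x a s = powIdeal x b s :=
  le_antisymm (powIdeal_mono x fun i hi => (h i hi).ge) (powIdeal_mono x fun i hi => (h i hi).le)

lemma powIdeal_insert (x : ι → R) (a : ι → ℕ) (s : Set ι) (t : ι) :
    powIdeal x a (insert t s) = powIdeal x a s ⊔ Ideal.span {x t ^ a t} := by
  rw [powIdeal, Set.image_insert_eq, Ideal.span_insert, sup_comm]
  rfl

/-- Multiplication by `y` gives an exact sequence `0 → R/(J + yⁿ) → R/(J + yⁿ⁺¹) → R/(J + y) → 0`,
and `x` is a nonzerodivisor on both ends. -/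
lemma Ideal.mem_sup_span_singleton_pow_succ {J : Ideal R} {x y : R} {n : ℕ}
    (h1 : ∀ r, x * r ∈ J ⊔ span {y} → r ∈ J ⊔ span {y})
    (hn : ∀ r, x * r ∈ J ⊔ span {y ^ n} → r ∈ J ⊔ span {y ^ n})
    (hy : ∀ r, y * r ∈ J → r ∈ J) (r : R) (h : x * r ∈ J ⊔ span {y ^ (n + 1)}) :
    r ∈ J ⊔ span {y ^ (n + 1)} := by
  have hr : r ∈ J ⊔ span {y} := h1 r (sup_le_sup_left (span_singleton_le_span_singleton.2
    (dvd_pow_self y n.succ_ne_zero)) J h)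
  obtain ⟨j, hj, c, hc, hjc⟩ := Submodule.mem_sup.1 h
  obtain ⟨j', hj', c', hc', rfl⟩ := Submodule.mem_sup.1 hr
  obtain ⟨c, rfl⟩ := mem_span_singleton'.1 hc
  obtain ⟨c', rfl⟩ := mem_span_singleton'.1 hc'
  have h2 : x * c' - c * y ^ n ∈ J := hy _ (by
    rw [show y * (x * c' - c * y ^ n) = j - x * j' by linear_combination -hjc]
    exact sub_mem hj (J.mul_mem_left _ hj'))
  obtain ⟨k, hk, e, he, hke⟩ := Submodule.mem_sup.1 (hn c' (by
    rw [← sub_add_cancel (x * c') (c * y ^ n)]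
    exact Submodule.add_mem_sup h2 (mem_span_singleton'.2 ⟨c, rfl⟩)))
  obtain ⟨e, rfl⟩ := mem_span_singleton'.1 he
  refine Submodule.mem_sup.2 ⟨j' + k * y, J.add_mem hj' (J.mul_mem_right _ hk), e * y ^ (n + 1),
    mem_span_singleton'.2 ⟨e, rfl⟩, ?_⟩
  rw [← hke]; ring

namespace IsPermutableRegular

variable {x : ι → R} (hx : IsPermutableRegular x)
include hx

/-- Powers of a permutable regular sequence form a permutable regular sequence. -/
theorem mem_powIdeal_of_mul_mem {s : Finset ι} {i : ι} (hi : i ∉ s) {a : ι → ℕ}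
    (ha : ∀ j ∈ s, 1 ≤ a j) {r : R} (h : x i * r ∈ powIdeal x a s) : r ∈ powIdeal x a s := by
  classical
  -- The induction is on the total exponent, with `i` and `s` free: it must cover both a lowered
  -- exponent at `t` and the removal of `t` from `s`, where `x t` becomes the multiplier.
  generalize hn : ∑ j ∈ s, a j = n
  induction n using Nat.strong_induction_on generalizing s a r i with
  | _ n ih =>
    by_cases h1 : ∀ j ∈ s, a j = 1
    · have : powIdeal x a s = Ideal.span (x '' s) :=
        congrArg Ideal.span (Set.image_congr fun j hj => by rw [h1 j hj, pow_one])
      rw [this] at h ⊢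
      exact hx s i hi r h
    · push Not at h1
      obtain ⟨t, hts, ht1⟩ := h1
      obtain ⟨m, hm⟩ : ∃ m, a t = m + 1 + 1 := ⟨a t - 2, by have := ha t hts; omega⟩
      have hsum : ∀ b : ι → ℕ, ∑ j ∈ s, b j = b t + ∑ j ∈ s.erase t, b j := fun b =>
        (Finset.add_sum_erase s b hts).symm
      have hupd : ∀ k, ∑ j ∈ s.erase t, Function.update a t k j = ∑ j ∈ s.erase t, a j :=
        fun k => Finset.sum_congr rfl fun j hj => Function.update_of_ne (Finset.ne_of_mem_erase hj) _ _
      have hpow : ∀ k, powIdeal x (Function.update a t k) s =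
          powIdeal x a (s.erase t : Finset ι) ⊔ Ideal.span {x t ^ k} := fun k => by
        conv_lhs => rw [← Finset.insert_erase hts, Finset.coe_insert, powIdeal_insert]
        rw [Function.update_self, powIdeal_congr x fun j hj =>
          Function.update_of_ne (Finset.ne_of_mem_erase hj) _ _]
      have hstep : ∀ k, 1 ≤ k → k < a t → ∀ r,
          x i * r ∈ powIdeal x a (s.erase t : Finset ι) ⊔ Ideal.span {x t ^ k} →
          r ∈ powIdeal x a (s.erase t : Finset ι) ⊔ Ideal.span {x t ^ k} := fun k hk hkt r hr => by
        rw [← hpow] at hr ⊢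
        refine ih _ ?_ hi (fun j hj => ?_) hr rfl
        · rw [← hn, hsum, hsum, hupd, Function.update_self]; omega
        · rcases eq_or_ne j t with rfl | hjt
          · rwa [Function.update_self]
          · rw [Function.update_of_ne hjt]; exact ha j hj
      have hself := hpow (a t)
      rw [Function.update_eq_self, hm] at hself
      rw [hself] at h ⊢
      refine Ideal.mem_sup_span_singleton_pow_succ (fun r hr => ?_)
        (hstep _ (by omega) (by omega)) (fun r hr => ?_) r h
      · have := hstep 1 le_rfl (by omega) r
        rw [pow_one] at this
        exact this hr
      · refine ih _ ?_ (Finset.notMem_erase t s) (fun j hj => ha j (Finset.mem_of_mem_erase hj)) hr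
          rfl
        rw [← hn, hsum]; omega

theorem mem_powIdeal_of_pow_mul_mem {s : Finset ι} {i : ι} (hi : i ∉ s) {a : ι → ℕ}
    (ha : ∀ j ∈ s, 1 ≤ a j) (n : ℕ) {r : R} (h : x i ^ n * r ∈ powIdeal x a s) :
    r ∈ powIdeal x a s := by
  induction n with
  | zero => rwa [pow_zero, one_mul] at h
  | succ n ih => exact ih (hx.mem_powIdeal_of_mul_mem hi ha (by rwa [← mul_assoc, ← pow_succ']))

variable [Fintype ι] [DecidableEq ι]

/-- Modulo the other powers, `x t ^ n * r` equals some `c * x t ^ (a t + n)`, and `x t ^ n` cancels.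
-/
theorem mem_powIdeal_of_pow_mul_mem_update {a : ι → ℕ} (ha : ∀ j, 1 ≤ a j) (t : ι) (n : ℕ) {r : R}
    (h : x t ^ n * r ∈ powIdeal x (Function.update a t (a t + n)) Set.univ) :
    r ∈ powIdeal x a Set.univ := by
  have huniv : (Set.univ : Set ι) =
      insert t ((Finset.univ.erase t : Finset ι) : Set ι) := by
    rw [← Finset.coe_insert, Finset.insert_erase (Finset.mem_univ t), Finset.coe_univ]
  rw [huniv, powIdeal_insert, Function.update_self, powIdeal_congr x fun j hj =>
    Function.update_of_ne (Finset.ne_of_mem_erase hj) _ _] at h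
  rw [huniv, powIdeal_insert]
  obtain ⟨j, hj, c, hc, hjc⟩ := Submodule.mem_sup.1 h
  obtain ⟨c, rfl⟩ := Ideal.mem_span_singleton'.1 hc
  have := hx.mem_powIdeal_of_pow_mul_mem (Finset.notMem_erase t Finset.univ) (fun j _ => ha j) n
    (r := r - c * x t ^ a t) (by
      rw [show x t ^ n * (r - c * x t ^ a t) = j by linear_combination -hjc]; exact hj)
  rw [← sub_add_cancel r (c * x t ^ a t)]
  exact Submodule.add_mem_sup this (Ideal.mem_span_singleton'.2 ⟨c, rfl⟩)

theorem mem_powIdeal_of_mul_prod_mem {a : ι → ℕ} (ha : ∀ j, 1 ≤ a j) (u : Finset ι) (n : ℕ) {r : R}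
    (h : r * ∏ i ∈ u, x i ^ n ∈
      powIdeal x (fun i => if i ∈ u then a i + n else a i) Set.univ) :
    r ∈ powIdeal x a Set.univ := by
  induction u using Finset.induction_on generalizing r with
  | empty => simpa using h
  | insert t u ht ih =>
    refine ih (hx.mem_powIdeal_of_pow_mul_mem_update (fun j => ?_) t n ?_)
    · split_ifs
      · exact (ha j).trans (Nat.le_add_right _ _)
      · exact ha j
    · rw [Finset.prod_insert ht] at h
      rw [show x t ^ n * (r * ∏ i ∈ u, x i ^ n) = r * (x t ^ n * ∏ i ∈ u, x i ^ n) by ring]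
      convert h using 2
      ext j
      rcases eq_or_ne j t with rfl | hjt
      · simp [ht]
      · simp [hjt]

/-- This colon ideal governs the inverse polynomials killed by all `x i ^ n`. Cancelling `x t ^ n`
puts `r` in each ideal with the exponent at `t` lowered to `b`; these conditions are combined one
index at a time. -/
theorem mem_sup_of_pow_mul_mem {n b : ℕ} (hn : 1 ≤ n) {r : R}
    (h : ∀ i, x i ^ n * r ∈ powIdeal x (fun _ => n + b) Set.univ) :
    r ∈ powIdeal x (fun _ => n + b) Set.univ ⊔ Ideal.span {∏ i, x i ^ b} := by
  rcases Nat.eq_zero_or_pos b with rfl | hb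
  · simp
  have hupd : ∀ t, r ∈ powIdeal x (Function.update (fun _ => n + b) t b) Set.univ := fun t => by
    refine hx.mem_powIdeal_of_pow_mul_mem_update (fun j => ?_) t n ?_
    · rcases eq_or_ne j t with rfl | hjt
      · rwa [Function.update_self]
      · rw [Function.update_of_ne hjt]; omega
    · rw [Function.update_self, Function.update_idem, add_comm b, Function.update_eq_self_iff.2 rfl]
      exact h t
  suffices ∀ u : Finset ι,
      r ∈ powIdeal x (fun _ => n + b) Set.univ ⊔ Ideal.span {∏ i ∈ u, x i ^ b} from this Finset.univ
  intro u
  induction u using Finset.induction_on with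
  | empty => simp
  | insert t u ht ih =>
    obtain ⟨j, hj, c, hc, rfl⟩ := Submodule.mem_sup.1 ih
    obtain ⟨c, rfl⟩ := Ideal.mem_span_singleton'.1 hc
    refine add_mem (Submodule.mem_sup_left hj) ?_
    have h1 : c * ∏ i ∈ u, x i ^ b ∈ powIdeal x (Function.update (fun _ => n + b) t b) Set.univ := by
      rw [← add_sub_cancel_left j (c * ∏ i ∈ u, x i ^ b)]
      refine sub_mem (hupd t) (powIdeal_mono x (fun i _ => ?_) hj)
      rcases eq_or_ne i t with rfl | hit
      · rw [Function.update_self]; omega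
      · rw [Function.update_of_ne hit]
    -- Cancelling the product over `u` lowers the exponents in `u` from `n + b` to `n`. On
    -- multiplying back, the generator at `t` enlarges the product, and every other one lands in the
    -- original ideal.
    have h2 : c ∈ powIdeal x (fun i => if i = t then b else if i ∈ u then n else n + b)
        Set.univ := by
      refine hx.mem_powIdeal_of_mul_prod_mem (fun j => by split_ifs <;> omega) u b ?_
      rwa [powIdeal_congr x (b := Function.update (fun _ => n + b) t b)]
      intro i _
      rcases eq_or_ne i t with rfl | hit
      · simp [ht]
      · simp only [Function.update_of_ne hit, if_neg hit]
        split_ifs <;> rfl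
    have h3 : c * ∏ i ∈ u, x i ^ b ∈
        powIdeal x (fun i => if i = t then b else if i ∈ u then n else n + b) Set.univ *
          Ideal.span {∏ i ∈ u, x i ^ b} := Ideal.mul_mem_mul h2 (Ideal.mem_span_singleton_self _)
    rw [powIdeal, Ideal.span_mul_span'] at h3
    refine Ideal.span_le.2 ?_ h3
    rintro _ ⟨_, ⟨i, -, rfl⟩, _, rfl, rfl⟩
    dsimp only
    split_ifs with hit hiu
    · subst hit
      rw [← Finset.prod_insert (f := fun i => x i ^ b) ht]
      exact Submodule.mem_sup_right (Ideal.mem_span_singleton_self _)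
    · refine Submodule.mem_sup_left ?_
      rw [← Finset.mul_prod_erase _ (fun i => x i ^ b) hiu, ← mul_assoc, ← pow_add]
      exact Ideal.mul_mem_right _ _ (pow_mem_powIdeal x (Set.mem_univ i) le_rfl)
    · exact Submodule.mem_sup_left
        (Ideal.mul_mem_right _ _ (pow_mem_powIdeal x (Set.mem_univ i) le_rfl))

end IsPermutableRegular

/-- A minimal system of generators of the maximal ideal of a regular local ring is a regular
sequence in any order. -/
theorem IsRegularLocalRing.isPermutableRegular [IsRegularLocalRing R] [Fintype ι] {x : ι → R}
    (hcard : Fintype.card ι = (maximalIdeal R).spanFinrank)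
    (hspan : Ideal.span (Set.range x) = maximalIdeal R) : IsPermutableRegular x := by
  classical
  intro s i hi r hr
  have hcov : ∀ s t : Finset ι, s ∪ t = Finset.univ →
      Ideal.span ((s.image x : Set R) ∪ (t.image x : Set R)) = maximalIdeal R := fun s t h => by
    rw [← hspan, Finset.coe_image, Finset.coe_image, ← Set.image_union, ← Finset.coe_union, h,
      Finset.coe_univ, Set.image_univ]
  have hle : ∀ s t : Finset ι, s.card + t.card = Fintype.card ι →
      (s.image x).card + (t.image x).card ≤ (maximalIdeal R).spanFinrank := fun s t h =>
    (Nat.add_le_add Finset.card_image_le Finset.card_image_le).trans (h.trans hcard).le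
  have hcompl : ∀ s : Finset ι, s.card + sᶜ.card = Fintype.card ι := fun s =>
    Finset.card_add_card_compl s
  obtain ⟨h1, h2⟩ := quotient_span _ _ (hcov s sᶜ (Finset.union_compl s)) (hle _ _ (hcompl s))
  have hdom := IsRegularLocalRing.isDomain (R ⧸ Ideal.span ((s.image x : Finset R) : Set R))
  rw [Ideal.Quotient.isDomain_iff_prime, Finset.coe_image] at hdom
  -- If `x i` were in the ideal of the others, it would be redundant, and `𝔪` would have fewer than
  -- the minimal number of generators.
  refine (hdom.mem_or_mem hr).resolve_left fun hmem => ?_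
  have hc1 : ((insert i s).card + (insert i s)ᶜ.card) = Fintype.card ι := hcompl _
  have hspan' : Ideal.span ((s.image x : Set R) ∪ (((insert i s)ᶜ : Finset ι).image x : Set R)) =
      maximalIdeal R := by
    rw [← hcov (insert i s) _ (Finset.union_compl _), Finset.image_insert, Finset.coe_insert,
      Set.insert_union, Ideal.span_insert, eq_comm, sup_eq_right, Ideal.span_singleton_le_iff_mem]
    refine Ideal.span_mono Set.subset_union_left ?_
    rwa [Finset.coe_image]
  have h3 : (maximalIdeal R).spanFinrank ≤
      (s.image x ∪ ((insert i s)ᶜ : Finset ι).image x).card := by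
    rw [← hspan', ← Finset.coe_union, ← Set.ncard_coe_finset]
    exact Submodule.spanFinrank_span_le_ncard_of_finite (Finset.finite_toSet _)
  have h4 := h3.trans (Finset.card_union_le _ _)
  have h5 : (s.image x).card ≤ s.card := Finset.card_image_le
  have h6 : (((insert i s)ᶜ : Finset ι).image x).card ≤ ((insert i s)ᶜ : Finset ι).card :=
    Finset.card_image_le
  rw [Finset.card_insert_of_notMem hi] at hc1
  omega

end PermutableRegular

/-! ### Inverse polynomials and their semilinear endomorphisms. -/

namespace InversePolynomials

variable {R : Type*} [CommRing R] {d : ℕ} (x : Fin d → R)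

lemma isUnit_algebraMap (i : Fin d) :
    IsUnit (algebraMap R (Localization.Away (∏ i, x i)) (x i)) := by
  have h := IsLocalization.Away.algebraMap_isUnit (S := Localization.Away (∏ i, x i)) (∏ i, x i)
  rw [map_prod] at h
  exact isUnit_of_dvd_unit
    (Finset.dvd_prod_of_mem (fun i => algebraMap R (Localization.Away (∏ i, x i)) (x i))
      (Finset.mem_univ i)) h

lemma prod_pow_smul_prod_inverse (n : ℕ) :
    (∏ i, x i) ^ n • ∏ i, Ring.inverse (algebraMap R (Localization.Away (∏ i, x i)) (x i)) ^ n =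
      1 := by
  rw [Algebra.smul_def, map_pow, map_prod, ← Finset.prod_pow, ← Finset.prod_mul_distrib]
  refine Finset.prod_eq_one fun i _ => ?_
  rw [← mul_pow, Ring.mul_inverse_cancel _ (isUnit_algebraMap x i), one_pow]

lemma prod_pow_smul_injective (n : ℕ) :
    Function.Injective fun a : Localization.Away (∏ i, x i) => (∏ i, x i) ^ n • a := by
  intro a b h
  have h' := congrArg
    ((∏ i, Ring.inverse (algebraMap R (Localization.Away (∏ i, x i)) (x i)) ^ n) * ·) h
  simpa only [mul_smul_comm, ← smul_mul_assoc, prod_pow_smul_prod_inverse, one_mul] using h'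

/-- The inverse monomial `(x₁ ⋯ x_d) ^ (-n)`. -/
noncomputable def diag (n : ℕ) : InversePolynomials x := monomial x fun _ => n

/-- With the next lemma, this exhibits the module as the increasing union of the cyclic submodules
generated by the `diag x n`. -/
lemma prod_pow_smul_diag (n m : ℕ) : (∏ i, x i) ^ m • diag x (n + m) = diag x n := by
  rw [diag, diag, monomial, monomial, ← map_smul]
  congr 1
  refine prod_pow_smul_injective x n ?_
  dsimp only
  rw [smul_smul, ← pow_add, prod_pow_smul_prod_inverse, prod_pow_smul_prod_inverse]

lemma exists_smul_diag (z : InversePolynomials x) (N : ℕ) :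
    ∃ n, N ≤ n ∧ ∃ r : R, z = r • diag x n := by
  obtain ⟨a, rfl⟩ := Submodule.mkQ_surjective _ z
  obtain ⟨n, r, hr⟩ := IsLocalization.Away.surj (∏ i, x i) a
  have ha : a = r • ∏ i, Ring.inverse (algebraMap R (Localization.Away (∏ i, x i)) (x i)) ^ n := by
    refine prod_pow_smul_injective x n ?_
    dsimp only
    rw [smul_comm, prod_pow_smul_prod_inverse, Algebra.smul_def, Algebra.smul_def, mul_one, map_pow,
      mul_comm, hr]
  refine ⟨n + N, Nat.le_add_left _ _, r * (∏ i, x i) ^ N, ?_⟩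
  rw [mul_smul, prod_pow_smul_diag, ha, diag, monomial, ← map_smul]
  rfl

lemma smul_diag_eq_zero_of_mem {n : ℕ} {r : R} (h : r ∈ powIdeal x (fun _ => n) Set.univ) :
    r • diag x n = 0 := by
  rw [← LinearMap.toSpanSingleton_apply R, ← LinearMap.mem_ker]
  refine (Ideal.span_le (I := LinearMap.ker (LinearMap.toSpanSingleton R _ (diag x n)))).2 ?_ h
  rintro _ ⟨i, -, rfl⟩
  rw [SetLike.mem_coe, LinearMap.mem_ker, LinearMap.toSpanSingleton_apply, diag, monomial,
    ← map_smul]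
  refine (Submodule.Quotient.mk_eq_zero _).2 (Submodule.subset_span ⟨i, n, 1, ?_⟩)
  dsimp only
  rw [smul_smul, ← mul_pow, mul_comm, Finset.mul_prod_erase _ _ (Finset.mem_univ i),
    prod_pow_smul_prod_inverse, map_one]

lemma pow_smul_diag {n m : ℕ} (h : n ≤ m) (i : Fin d) : x i ^ m • diag x n = 0 :=
  smul_diag_eq_zero_of_mem x (pow_mem_powIdeal x (Set.mem_univ i) h)

lemma prod_pow_mul_mem_powIdeal {N : ℕ} (m : ℕ) {s : R}
    (hs : s ∈ powIdeal x (fun _ => N) Set.univ) :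
    (∏ i, x i) ^ m * s ∈ powIdeal x (fun _ => N + m) Set.univ := by
  have h := Ideal.mul_mem_mul (Ideal.mem_span_singleton_self ((∏ i, x i) ^ m)) hs
  rw [powIdeal, Ideal.span_mul_span'] at h
  refine Ideal.span_le.2 ?_ h
  rintro _ ⟨_, rfl, _, ⟨i, -, rfl⟩, rfl⟩
  dsimp only
  rw [← Finset.mul_prod_erase _ _ (Finset.mem_univ i), mul_pow, mul_right_comm, ← pow_add,
    add_comm m]
  exact Ideal.mul_mem_right _ _ (pow_mem_powIdeal x (Set.mem_univ i) le_rfl)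

/-- Relations with different omitted variables are put over a common denominator; raising the
denominator keeps the numerator in the corresponding power ideal. -/
lemma exists_of_mem_relations {a : Localization.Away (∏ i, x i)} (ha : a ∈ relations x) :
    ∃ N, ∃ s ∈ powIdeal x (fun _ => N) Set.univ, (∏ i, x i) ^ N • a = algebraMap R _ s := by
  induction ha using Submodule.span_induction with
  | mem a h =>
    obtain ⟨i, k, r, h⟩ := h
    refine ⟨k, x i ^ k * r, Ideal.mul_mem_right _ _ (pow_mem_powIdeal x (Set.mem_univ i) le_rfl), ?_⟩
    have hprod : (∏ i, x i) ^ k = x i ^ k * (∏ j ∈ Finset.univ.erase i, x j) ^ k := by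
      rw [← mul_pow, Finset.mul_prod_erase _ _ (Finset.mem_univ i)]
    rw [hprod, mul_smul, h, Algebra.smul_def, map_mul]
  | zero => exact ⟨0, 0, zero_mem _, by rw [smul_zero, map_zero]⟩
  | add a b _ _ ha hb =>
    obtain ⟨N, s, hs, ha⟩ := ha
    obtain ⟨M, t, ht, hb⟩ := hb
    refine ⟨N + M, (∏ i, x i) ^ M * s + (∏ i, x i) ^ N * t, add_mem
      (prod_pow_mul_mem_powIdeal x M hs) (add_comm N M ▸ prod_pow_mul_mem_powIdeal x N ht), ?_⟩
    rw [map_add, map_mul, map_mul, ← ha, ← hb, ← Algebra.smul_def, ← Algebra.smul_def, smul_smul,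
      smul_smul, ← pow_add, ← pow_add, add_comm M, smul_add]
  | smul r a _ ha =>
    obtain ⟨N, s, hs, ha⟩ := ha
    exact ⟨N, r * s, Ideal.mul_mem_left _ _ hs, by
      rw [smul_comm, ha, Algebra.smul_def, map_mul]⟩

variable {x}

/-- Clearing denominators, a power of `∏ i, x i` times `r` lies in a correspondingly higher power
ideal, and regularity cancels that power. -/
lemma mem_powIdeal_of_smul_diag_eq_zero (hx : IsPermutableRegular x) {n : ℕ} (hn : 1 ≤ n) {r : R}
    (h : r • diag x n = 0) : r ∈ powIdeal x (fun _ => n) Set.univ := by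
  rw [diag, monomial, ← map_smul] at h
  obtain ⟨N, s, hs, hN⟩ := exists_of_mem_relations x ((Submodule.Quotient.mk_eq_zero _).1 h)
  have h1 : algebraMap R (Localization.Away (∏ i, x i)) ((∏ i, x i) ^ N * r) =
      algebraMap R _ ((∏ i, x i) ^ n * s) := by
    rw [map_mul _ (_ ^ n), ← hN, ← Algebra.smul_def, smul_comm ((∏ i, x i) ^ n),
      smul_comm ((∏ i, x i) ^ n), prod_pow_smul_prod_inverse, smul_smul, Algebra.smul_def, mul_one]
  obtain ⟨⟨_, k, rfl⟩, hk⟩ := (IsLocalization.eq_iff_exists (Submonoid.powers (∏ i, x i)) _).1 h1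
  refine hx.mem_powIdeal_of_mul_prod_mem (a := fun _ => n) (fun _ => hn) Finset.univ (k + N) ?_
  simp only [Finset.mem_univ, if_true]
  rw [Finset.prod_pow, mul_comm, pow_add, mul_assoc]
  rw [show (∏ i, x i) ^ k * ((∏ i, x i) ^ N * r) = (∏ i, x i) ^ (k + n) * s by
    rw [pow_add, mul_assoc]; exact hk]
  rw [show (fun _ : Fin d => n + (k + N)) = fun _ => N + (k + n) by ext; ring]
  exact prod_pow_mul_mem_powIdeal x _ hs

/-- Write `z = s • diag x (n + b)`. By the colon computation `s` is a multiple of `∏ i, x i ^ b` up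
to an element killing `diag x (n + b)`, and that product brings it down to `diag x n`. -/
lemma exists_smul_diag_of_pow_smul_eq_zero (hx : IsPermutableRegular x) {n : ℕ} (hn : 1 ≤ n)
    {z : InversePolynomials x} (h : ∀ i, x i ^ n • z = 0) : ∃ r : R, z = r • diag x n := by
  obtain ⟨m, hm, s, rfl⟩ := exists_smul_diag x z n
  obtain ⟨b, rfl⟩ := Nat.exists_eq_add_of_le hm
  have hs := hx.mem_sup_of_pow_mul_mem (b := b) hn (r := s) fun i =>
    mem_powIdeal_of_smul_diag_eq_zero hx (hn.trans hm) (by rw [mul_smul, h i])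
  obtain ⟨j, hj, c, hc, rfl⟩ := Submodule.mem_sup.1 hs
  obtain ⟨c, rfl⟩ := Ideal.mem_span_singleton'.1 hc
  refine ⟨c, ?_⟩
  rw [add_smul, smul_diag_eq_zero_of_mem x hj, zero_add, mul_smul, Finset.prod_pow,
    prod_pow_smul_diag]

section Local

variable [IsLocalRing R] (hspan : Ideal.span (Set.range x) = maximalIdeal R)
include hspan

lemma exists_pow_le_powIdeal (n : ℕ) :
    ∃ k, maximalIdeal R ^ k ≤ powIdeal x (fun _ => n) Set.univ := by
  refine Ideal.exists_pow_le_of_le_radical_of_fg ?_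
    (hspan ▸ Submodule.fg_span (Set.finite_range x))
  rw [← hspan, Ideal.span_le]
  rintro _ ⟨i, rfl⟩
  exact ⟨n, pow_mem_powIdeal x (Set.mem_univ i) le_rfl⟩

lemma powIdeal_le_pow (n : ℕ) : powIdeal x (fun _ => n) Set.univ ≤ maximalIdeal R ^ n := by
  refine Ideal.span_le.2 ?_
  rintro _ ⟨i, -, rfl⟩
  exact Ideal.pow_mem_pow (hspan ▸ Ideal.subset_span ⟨i, rfl⟩) n

/-- Over a complete local ring, every `q`-semilinear endomorphism of the inverse polynomials is a
unique multiple of one which takes `q`-th powers of the inverse monomials. -/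
theorem existsUnique_eq_smul [IsAdicComplete (maximalIdeal R) R] (hx : IsPermutableRegular x)
    {q : ℕ} (hq : 1 ≤ q) (T g : InversePolynomials x →+ InversePolynomials x)
    (hT : ∀ (r : R) a, T (r • a) = r ^ q • T a) (hTd : ∀ n, T (diag x n) = diag x (q * n))
    (hg : ∀ (r : R) a, g (r • a) = r ^ q • g a) :
    ∃! r : R, ∀ a, g a = r • T a := by
  have hqn : ∀ n, 1 ≤ n → 1 ≤ q * n := fun n hn => Nat.mul_pos hq hn
  have hle : ∀ n, n ≤ q * n := fun n => Nat.le_mul_of_pos_left n hq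
  refine existsUnique_of_exists_of_unique ?_ fun r s hr hs => ?_
  -- By semilinearity `x i ^ (q * (n + 1))` kills the image of `diag x (n + 1)`. The shift to `n +
  -- 1` keeps the exponents positive.
  · have h1 : ∀ n, ∃ r : R, g (diag x (n + 1)) = r • diag x (q * (n + 1)) := fun n => by
      refine exists_smul_diag_of_pow_smul_eq_zero hx (hqn _ (by omega)) fun i => ?_
      rw [mul_comm q, pow_mul, ← hg, pow_smul_diag x le_rfl, map_zero]
    choose f hf using h1
    have hf' : ∀ n k, g (diag x (n + 1)) = f (n + k) • diag x (q * (n + 1)) := fun n k => by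
      have h := prod_pow_smul_diag x (n + 1) k
      rw [← h, hg, show n + 1 + k = n + k + 1 by ring, hf, smul_comm, ← pow_mul, mul_comm k,
        show q * (n + k + 1) = q * (n + 1) + q * k by ring, prod_pow_smul_diag]
    -- Later multipliers also serve for `diag x (m + 1)`, so they agree with `f m` modulo its
    -- annihilator, which lies in `𝔪 ^ (q * (m + 1))`: the sequence is Cauchy.
    obtain ⟨r, hr⟩ := IsPrecomplete.prec (I := maximalIdeal R) (M := R) inferInstance (f := f)
      (fun {m n} hmn => by
        obtain ⟨k, rfl⟩ := Nat.exists_eq_add_of_le hmn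
        rw [SModEq.sub_mem, smul_eq_mul, Ideal.mul_top]
        refine Ideal.pow_le_pow_right ((Nat.le_succ m).trans (hle _)) (powIdeal_le_pow hspan _
          (mem_powIdeal_of_smul_diag_eq_zero hx (hqn (m + 1) (by omega)) ?_))
        rw [sub_smul, ← hf, ← hf' m k, sub_self])
    have hmain : ∀ n, g (diag x (n + 1)) = r • diag x (q * (n + 1)) := fun n => by
      obtain ⟨k, hk⟩ := exists_pow_le_powIdeal hspan (q * (n + 1))
      have := hr (n + k)
      rw [SModEq.sub_mem, smul_eq_mul, Ideal.mul_top] at this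
      have h0 := smul_diag_eq_zero_of_mem x (hk (Ideal.pow_le_pow_right (Nat.le_add_left k n) this))
      rw [sub_smul, sub_eq_zero] at h0
      rw [hf' n k, h0]
    refine ⟨r, fun a => ?_⟩
    obtain ⟨n, hn, s, rfl⟩ := exists_smul_diag x a 1
    obtain ⟨n, rfl⟩ := Nat.exists_eq_add_of_le' hn
    rw [hg, hT, hTd, hmain, smul_comm]
  · rw [← sub_eq_zero]
    refine IsHausdorff.haus (I := maximalIdeal R) inferInstance _ fun n => ?_
    rw [SModEq.sub_mem, smul_eq_mul, Ideal.mul_top, sub_zero]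
    refine Ideal.pow_le_pow_right ((Nat.le_succ n).trans (hle _)) (powIdeal_le_pow hspan _
      (mem_powIdeal_of_smul_diag_eq_zero hx (hqn (n + 1) (by omega)) ?_))
    rw [sub_smul, sub_eq_zero, ← hTd, ← hr, ← hs]

end Local

end InversePolynomials

/-! ### The socle of `E`, lengths of Matlis duals, and `E` as the inverse polynomials. -/

section HullResidueField

variable {R : Type u} [CommRing R] [IsLocalRing R]

/-- A nonzero element killed by a power of `𝔪` has a nonzero multiple killed by `𝔪`. -/
lemma IsLocalRing.exists_smul_ne_zero_of_pow_smul_eq_zero {M : Type*} [AddCommGroup M] [Module R M]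
    {z : M} (hz : z ≠ 0) {k : ℕ} (h : ∀ r ∈ maximalIdeal R ^ k, r • z = 0) :
    ∃ r : R, r • z ≠ 0 ∧ ∀ s ∈ maximalIdeal R, s • r • z = 0 := by
  induction k with
  | zero => exact absurd (by simpa using h 1 (by simp)) hz
  | succ k ih =>
    by_cases hk : ∀ r ∈ maximalIdeal R ^ k, r • z = 0
    · exact ih hk
    · push Not at hk
      obtain ⟨r, hr, hrz⟩ := hk
      exact ⟨r, hrz, fun s hs => by
        rw [smul_smul]; exact h _ (pow_succ' (maximalIdeal R) k ▸ Ideal.mul_mem_mul hs hr)⟩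

lemma IsLocalRing.isUnit_of_smul_ne_zero {M : Type*} [AddCommGroup M] [Module R M] {w : M}
    (hw : ∀ r ∈ maximalIdeal R, r • w = 0) {r : R} (h : r • w ≠ 0) : IsUnit r :=
  notMem_maximalIdeal.1 fun hr => h (hw r hr)

variable {E : Type u} [AddCommGroup E] [Module R E]

/-- The map from the residue field to a module given by an element killed by the maximal ideal. -/
noncomputable def residueLift (w : E) (hw : ∀ r ∈ maximalIdeal R, r • w = 0) : ResidueField R →ₗ[R] E :=
  (maximalIdeal R).liftQ (LinearMap.toSpanSingleton R E w) hw

lemma residueLift_residue (w : E) (hw : ∀ r ∈ maximalIdeal R, r • w = 0) (r : R) :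
    residueLift w hw (residue R r) = r • w := rfl

lemma residueLift_injective {w : E} (hw : ∀ r ∈ maximalIdeal R, r • w = 0) (h0 : w ≠ 0) :
    Function.Injective (residueLift w hw) := by
  refine (injective_iff_map_eq_zero _).2 fun c hc => ?_
  obtain ⟨r, rfl⟩ := residue_surjective c
  rw [residueLift_residue] at hc
  rw [residue_eq_zero_iff]
  by_contra hr
  exact h0 ((notMem_maximalIdeal.1 hr).smul_eq_zero.1 hc)

/-- An element of `E` generating an essential copy of the residue field. -/
structure IsSocleGenerator (w : E) : Prop where
  ne_zero : w ≠ 0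
  smul_eq_zero : ∀ r ∈ maximalIdeal R, r • w = 0
  exists_smul_eq : ∀ a : E, a ≠ 0 → ∃ r : R, r • a = w

lemma IsInjectiveHull.exists_isSocleGenerator (hE : IsInjectiveHull R (ResidueField R) E) :
    ∃ w : E, IsSocleGenerator (R := R) w := by
  obtain ⟨-, i, hi, hess⟩ := hE
  have hw : ∀ r ∈ maximalIdeal R, r • i 1 = 0 := fun r hr => by
    rw [← map_smul, Algebra.smul_def, mul_one, ResidueField.algebraMap_eq,
      (residue_eq_zero_iff r).2 hr, map_zero]
  refine ⟨i 1, fun h => one_ne_zero (hi (h.trans (map_zero i).symm)), hw, fun a ha => ?_⟩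
  have : Submodule.span R {a} ⊓ LinearMap.range i ≠ ⊥ := fun h =>
    ha (Submodule.span_singleton_eq_bot.1 (hess _ h))
  obtain ⟨b, ⟨hb, c, rfl⟩, hb0⟩ := Submodule.exists_mem_ne_zero_of_ne_bot this
  obtain ⟨r, hr⟩ := Submodule.mem_span_singleton.1 hb
  obtain ⟨s, rfl⟩ := residue_surjective c
  have hs : i (residue R s) = s • i 1 := by
    rw [← map_smul, Algebra.smul_def, mul_one, ResidueField.algebraMap_eq]
  obtain ⟨t, ht⟩ := (isUnit_of_smul_ne_zero hw (hs ▸ hb0)).exists_left_inv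
  exact ⟨t * r, by rw [mul_smul, hr, hs, smul_smul, ht, one_smul]⟩

namespace IsSocleGenerator

variable {w : E} (hw : IsSocleGenerator (R := R) w)
include hw

lemma exists_eq_smul {a : E} (ha : ∀ r ∈ maximalIdeal R, r • a = 0) : ∃ r : R, a = r • w := by
  by_cases h0 : a = 0
  · exact ⟨0, by rw [h0, zero_smul]⟩
  obtain ⟨r, hr⟩ := hw.exists_smul_eq a h0
  obtain ⟨t, ht⟩ := (isUnit_of_smul_ne_zero ha (hr ▸ hw.ne_zero)).exists_left_inv
  exact ⟨t, by rw [← hr, smul_smul, ht, one_smul]⟩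

/-- Otherwise essentiality would put `w` in `𝔪ᵏ a` for every `k`, against Krull's intersection
theorem for the cyclic module `R a`. -/
lemma exists_pow_smul_eq_zero [IsNoetherianRing R] (a : E) :
    ∃ k, ∀ r ∈ maximalIdeal R ^ k, r • a = 0 := by
  by_contra! hcon
  have ha : a ∈ Submodule.span R {a} := Submodule.mem_span_singleton_self a
  have hall : ∀ k, ∃ r ∈ maximalIdeal R ^ k, r • a = w := fun k => by
    obtain ⟨r, hr, hra⟩ := hcon k
    obtain ⟨s, hs⟩ := hw.exists_smul_eq _ hra
    exact ⟨s * r, Ideal.mul_mem_left _ s hr, by rw [mul_smul, hs]⟩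
  have hwa : w ∈ Submodule.span R {a} := by
    obtain ⟨r, -, hr⟩ := hall 0
    exact Submodule.mem_span_singleton.2 ⟨r, hr⟩
  have hmem : (⟨w, hwa⟩ : Submodule.span R {a}) ∈
      (⨅ i : ℕ, maximalIdeal R ^ i • ⊤ : Submodule R (Submodule.span R {a})) := by
    refine Submodule.mem_iInf _ |>.2 fun k => ?_
    obtain ⟨r, hr, hra⟩ := hall k
    have : (⟨w, hwa⟩ : Submodule.span R {a}) = r • ⟨a, ha⟩ := Subtype.ext hra.symm
    rw [this]
    exact Submodule.smul_mem_smul hr trivial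
  rw [Ideal.iInf_pow_smul_eq_bot_of_isLocalRing _ (maximalIdeal.isMaximal R).ne_top] at hmem
  exact hw.ne_zero (congrArg Subtype.val ((Submodule.mem_bot R).1 hmem))

/-- A simple module is killed by `𝔪`, so its maps to `E` land in the line `R w`, and any two nonzero
ones are proportional. -/
lemma length_hom_le_one (M : Type*) [AddCommGroup M] [Module R M] [IsSimpleModule R M] :
    Module.length R (M →ₗ[R] E) ≤ 1 := by
  have hM : ∀ (m : M), ∀ r ∈ maximalIdeal R, r • m = 0 := fun m r hr => by
    rw [← IsLocalRing.eq_maximalIdeal (IsSimpleModule.annihilator_isMaximal (R := R) (M := M))] at hr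
    exact Module.mem_annihilator.1 hr m
  rcases subsingleton_or_nontrivial (M →ₗ[R] E) with h | h
  · rw [Module.length_eq_zero]; exact zero_le_one
  · refine le_of_eq (Module.length_eq_one_iff.2 ?_)
    refine isSimpleModule_iff_toSpanSingleton_surjective.2 ⟨h, fun φ hφ ψ => ?_⟩
    obtain ⟨m, hm⟩ : ∃ m, φ m ≠ 0 := by
      by_contra! h0
      exact hφ (LinearMap.ext h0)
    have hm0 : m ≠ 0 := fun h0 => hm (by rw [h0, map_zero])
    have hkill : ∀ χ : M →ₗ[R] E, ∀ r ∈ maximalIdeal R, r • χ m = 0 := fun χ r hr => by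
      rw [← map_smul, hM m r hr, map_zero]
    obtain ⟨r, hr⟩ := hw.exists_smul_eq _ hm
    obtain ⟨s, hs⟩ := hw.exists_eq_smul (hkill ψ)
    refine ⟨s * r, LinearMap.ext fun n => ?_⟩
    obtain ⟨t, rfl⟩ := IsSimpleModule.toSpanSingleton_surjective R hm0 n
    simp only [LinearMap.toSpanSingleton_apply, map_smul, LinearMap.smul_apply]
    rw [mul_smul, hr, hs]

/-- The Matlis dual of a module of finite length is no longer than the module. -/
theorem length_hom_le {M : Type*} [AddCommGroup M] [Module R M] (hM : IsFiniteLength R M) :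
    Module.length R (M →ₗ[R] E) ≤ Module.length R M := by
  induction hM with
  | of_subsingleton => rw [Module.length_eq_zero]; exact zero_le
  | @of_simple_quotient M _ _ N _ _ ih =>
    rw [Module.length_eq_add_of_exact N.subtype N.mkQ N.injective_subtype N.mkQ_surjective
      (LinearMap.exact_subtype_mkQ N), Module.length_eq_one R (M ⧸ N)]
    -- Left exactness suffices for an upper bound: restriction to `N` has kernel `Hom(M/N, E)`, and
    -- its range embeds in `Hom(N, E)`.
    let g := LinearMap.lcomp R E N.subtype
    rw [Module.length_eq_add_of_exact (LinearMap.lcomp R E N.mkQ) g.rangeRestrict ?_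
      g.surjective_rangeRestrict ?_, add_comm]
    · exact add_le_add ((Module.length_le_of_injective (LinearMap.range g).subtype
        (Submodule.injective_subtype _)).trans ih) (hw.length_hom_le_one _)
    · intro φ ψ h
      exact LinearMap.ext fun a => by
        obtain ⟨a, rfl⟩ := N.mkQ_surjective a
        exact LinearMap.congr_fun h a
    · intro φ
      constructor
      · intro h
        have h' : ∀ n ∈ N, φ n = 0 := fun n hn =>
          LinearMap.congr_fun (congrArg Subtype.val h) ⟨n, hn⟩
        exact ⟨N.liftQ φ h', N.liftQ_mkQ φ h'⟩
      · rintro ⟨φ, rfl⟩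
        refine Subtype.ext (LinearMap.ext fun n => ?_)
        change φ (N.mkQ n) = 0
        rw [N.mkQ_apply, (Submodule.Quotient.mk_eq_zero N).2 n.2, map_zero]

end IsSocleGenerator

omit [IsLocalRing R] in
lemma LinearMap.surjective_of_injective_of_length_le {A B : Type*} [AddCommGroup A] [Module R A]
    [AddCommGroup B] [Module R B] (f : A →ₗ[R] B) (hf : Function.Injective f)
    (hA : IsFiniteLength R A) (h : Module.length R B ≤ Module.length R A) :
    Function.Surjective f := by
  have hB : IsFiniteLength R B := Module.length_ne_top_iff.1
    (ne_top_of_le_ne_top (Module.length_ne_top_iff.2 hA) h)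
  obtain ⟨_, _⟩ := isFiniteLength_iff_isNoetherian_isArtinian.1 hB
  rw [← LinearMap.range_eq_top]
  by_contra hne
  have := Submodule.length_lt hne
  rw [← (LinearEquiv.ofInjective f hf).length_eq] at this
  exact absurd h (not_le.2 this)

lemma IsLocalRing.isFiniteLength_quotient [IsNoetherianRing R] {I : Ideal R}
    (hI : I ≤ maximalIdeal R) {k : ℕ} (hk : maximalIdeal R ^ k ≤ I) : IsFiniteLength R (R ⧸ I) := by
  have hloc := IsLocalRing.quotient_of_le_maximalIdeal hI
  have : IsArtinianRing (R ⧸ I) := by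
    refine (isArtinianRing_iff_isNilpotent_maximalIdeal _).2 ⟨k, ?_⟩
    rw [← map_maximalIdeal_of_surjective (Ideal.Quotient.mk I) Ideal.Quotient.mk_surjective,
      ← Ideal.map_pow, Ideal.zero_eq_bot, Ideal.map_eq_bot_iff_le_ker, Ideal.mk_ker]
    exact hk
  have : IsArtinian R (R ⧸ I) :=
    isArtinian_of_surjective_algebraMap (R := R ⧸ I) Ideal.Quotient.mk_surjective
  exact isFiniteLength_iff_isNoetherian_isArtinian.2 ⟨inferInstance, this⟩

namespace InversePolynomials

variable [IsNoetherianRing R] {d : ℕ} {x : Fin d → R}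
  (hspan : Ideal.span (Set.range x) = maximalIdeal R) (hx : IsPermutableRegular x)
include hspan hx

-- Every nonzero element is killed by a power of `𝔪`, so some nonzero multiple is killed by all `x
-- i`; that multiple is a unit times `diag x 1`.
omit [IsNoetherianRing R] in
lemma isSocleGenerator_diag_one : IsSocleGenerator (R := R) (diag x 1) := by
  have hmem : ∀ i, x i ∈ maximalIdeal R := fun i => hspan ▸ Ideal.subset_span ⟨i, rfl⟩
  have hkill : ∀ r ∈ maximalIdeal R, r • diag x 1 = 0 := fun r hr => by
    refine smul_diag_eq_zero_of_mem x ((hspan.symm.trans_le (Ideal.span_le.2 ?_)) hr)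
    rintro _ ⟨i, rfl⟩
    exact pow_one (x i) ▸ pow_mem_powIdeal x (Set.mem_univ i) le_rfl
  have hne : diag x 1 ≠ 0 := fun h => by
    have := mem_powIdeal_of_smul_diag_eq_zero hx le_rfl (r := 1) (by rw [h, smul_zero])
    have := powIdeal_le_pow hspan 1 this
    rw [pow_one] at this
    exact (maximalIdeal.isMaximal R).ne_top ((Ideal.eq_top_iff_one _).2 this)
  refine ⟨hne, hkill, fun a ha => ?_⟩
  obtain ⟨n, -, s, rfl⟩ := exists_smul_diag x a 0
  obtain ⟨k, hk⟩ := exists_pow_le_powIdeal hspan n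
  obtain ⟨r, hr0, hr⟩ := IsLocalRing.exists_smul_ne_zero_of_pow_smul_eq_zero (R := R) ha (k := k)
    fun r hr => by
      rw [smul_comm r s (diag x n), smul_diag_eq_zero_of_mem x (hk hr), smul_zero]
  obtain ⟨t, ht⟩ := exists_smul_diag_of_pow_smul_eq_zero hx le_rfl
    (z := r • s • diag x n) fun i => by rw [pow_one]; exact hr _ (hmem i)
  rw [ht] at hr0
  obtain ⟨v, hv⟩ := (isUnit_of_smul_ne_zero hkill hr0).exists_left_inv
  exact ⟨v * r, by rw [mul_smul, ht, smul_smul, hv, one_smul]⟩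

/-- The inverse polynomials in a regular system of parameters form an injective hull of the residue
field. -/
theorem nonempty_linearEquiv (hE : IsInjectiveHull R (ResidueField R) E) :
    Nonempty (E ≃ₗ[R] InversePolynomials x) := by
  obtain ⟨w, hw⟩ := hE.exists_isSocleGenerator
  have hd := isSocleGenerator_diag_one hspan hx
  have := hE.1
  -- The identification of socles extends to `h` by injectivity of `E`; `h` is injective because it
  -- is so on the essential socle.
  obtain ⟨h, hh⟩ := Module.Injective.extension_property R E _ _
    (residueLift (diag x 1) hd.smul_eq_zero) (residueLift_injective hd.smul_eq_zero hd.ne_zero)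
    (residueLift w hw.smul_eq_zero)
  have hdw : h (diag x 1) = w := by
    have := LinearMap.congr_fun hh (residue R 1)
    rwa [LinearMap.comp_apply, residueLift_residue, residueLift_residue, one_smul, one_smul] at this
  have hinj : Function.Injective h := by
    refine (injective_iff_map_eq_zero _).2 fun z hz => ?_
    by_contra h0
    obtain ⟨r, hr⟩ := hd.exists_smul_eq z h0
    rw [← hr, map_smul, hz, smul_zero] at hdw
    exact hw.ne_zero hdw.symm
  refine ⟨(LinearEquiv.ofBijective h ⟨hinj, fun a => ?_⟩).symm⟩
  obtain ⟨n, hn⟩ := hw.exists_pow_smul_eq_zero a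
  set I := powIdeal x (fun _ => n + 1) Set.univ with hI
  obtain ⟨k, hk⟩ := exists_pow_le_powIdeal hspan (n + 1)
  have hle : I ≤ maximalIdeal R :=
    (powIdeal_le_pow hspan (n + 1)).trans (Ideal.pow_le_self n.succ_ne_zero)
  have hfin := IsLocalRing.isFiniteLength_quotient hle hk
  -- Surjectivity of `h`: an element `a` killed by `𝔪ⁿ` is a map `R/I → E`. The map `Φ : R/I →
  -- Hom(R/I, E)` built from `h (diag x (n + 1))` is injective, hence onto by length, so `a` is a
  -- multiple of that element. The exponent `n + 1` makes `I` proper.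
  let Φ : (R ⧸ I) →ₗ[R] (R ⧸ I) →ₗ[R] E :=
    Submodule.liftQ I (LinearMap.toSpanSingleton R ((R ⧸ I) →ₗ[R] E)
      (Submodule.liftQ I (LinearMap.toSpanSingleton R E (h (diag x (n + 1)))) fun r hr => by
        rw [LinearMap.mem_ker, LinearMap.toSpanSingleton_apply, ← map_smul,
          smul_diag_eq_zero_of_mem x hr, map_zero])) fun r hr => by
      refine LinearMap.ext fun c => ?_
      obtain ⟨s, rfl⟩ := Submodule.mkQ_surjective _ c
      change r • s • h (diag x (n + 1)) = 0
      rw [smul_comm, ← map_smul, smul_diag_eq_zero_of_mem x hr, map_zero, smul_zero]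
  have hΦ : ∀ r s : R, Φ (I.mkQ r) (I.mkQ s) = r • s • h (diag x (n + 1)) := fun _ _ => rfl
  have hΦinj : Function.Injective Φ := by
    refine (injective_iff_map_eq_zero _).2 fun c hc => ?_
    obtain ⟨r, rfl⟩ := Submodule.mkQ_surjective _ c
    refine (Submodule.Quotient.mk_eq_zero _).2
      (mem_powIdeal_of_smul_diag_eq_zero hx (by omega) (hinj ?_))
    rw [map_smul, map_zero]
    have := LinearMap.congr_fun hc (I.mkQ 1)
    rwa [hΦ, one_smul] at this
  obtain ⟨c, hc⟩ := LinearMap.surjective_of_injective_of_length_le Φ hΦinj hfin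
    (hw.length_hom_le hfin) (Submodule.liftQ I (LinearMap.toSpanSingleton R E a) fun r hr =>
      hn r (Ideal.pow_le_pow_right n.le_succ (powIdeal_le_pow hspan _ hr)))
  obtain ⟨r, rfl⟩ := Submodule.mkQ_surjective _ c
  refine ⟨r • diag x (n + 1), ?_⟩
  rw [map_smul]
  have := LinearMap.congr_fun hc (I.mkQ 1)
  rw [hΦ, one_smul] at this
  rw [this]
  exact one_smul R a

end InversePolynomials

end HullResidueField

/-! ### Injective hulls and Matlis' decomposition of injective modules. -/

section Matlis

variable {R : Type u} [CommRing R] {M : Type u} [AddCommGroup M] [Module R M]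

lemma Module.Injective.of_linearEquiv {N : Type u} [AddCommGroup N] [Module R N] (e : M ≃ₗ[R] N)
    (h : Module.Injective R M) : Module.Injective R N :=
  (Module.Baer.of_equiv e (Module.Baer.of_injective h)).injective

lemma IsInjectiveHull.of_linearEquiv {K E E' : Type u} [AddCommGroup K] [Module R K]
    [AddCommGroup E] [Module R E] [AddCommGroup E'] [Module R E'] (e : E ≃ₗ[R] E')
    (h : IsInjectiveHull R K E) : IsInjectiveHull R K E' := by
  obtain ⟨hinj, i, hi, hess⟩ := h
  refine ⟨hinj.of_linearEquiv e, e.toLinearMap ∘ₗ i, e.injective.comp hi, fun N hN => ?_⟩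
  have h1 : N.comap e.toLinearMap = ⊥ := hess _ ((Submodule.eq_bot_iff _).2 fun a ha => by
    obtain ⟨ha, k, rfl⟩ := ha
    have : e (i k) ∈ N ⊓ LinearMap.range (e.toLinearMap ∘ₗ i) := ⟨ha, k, rfl⟩
    rw [hN, Submodule.mem_bot] at this
    exact e.map_eq_zero_iff.1 this)
  refine (Submodule.eq_bot_iff _).2 fun b hb => ?_
  have : e.symm b ∈ N.comap e.toLinearMap := by simpa using hb
  rw [h1, Submodule.mem_bot] at this
  exact e.symm.map_eq_zero_iff.1 this

lemma Module.Injective.of_isCompl {A C : Submodule R M} (hAC : IsCompl A C)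
    (h : Module.Injective R M) : Module.Injective R A := by
  refine ⟨fun X Y _ _ _ _ f hf g => ?_⟩
  obtain ⟨k, hk⟩ := h.out f hf (A.subtype ∘ₗ g)
  refine ⟨A.projectionOnto C hAC ∘ₗ k, fun a => ?_⟩
  rw [LinearMap.comp_apply, hk]
  exact Submodule.projectionOnto_apply_left hAC (g a)

lemma Module.Injective.exists_isCompl_range {E : Type u} [AddCommGroup E] [Module R E]
    (h : Module.Injective R E) (f : E →ₗ[R] M) (hf : Function.Injective f) :
    ∃ C, IsCompl (LinearMap.range f) C := by
  obtain ⟨g, hg⟩ := h.out f hf LinearMap.id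
  refine ⟨LinearMap.ker (f.rangeRestrict ∘ₗ g), LinearMap.isCompl_of_proj ?_⟩
  rintro ⟨_, a, rfl⟩
  exact Subtype.ext (congrArg f (hg a))

lemma Submodule.exists_le_maximal_disjoint {A B : Submodule R M} (h : Disjoint A B) :
    ∃ C, B ≤ C ∧ Disjoint A C ∧ ∀ D, C ≤ D → Disjoint A D → D ≤ C := by
  obtain ⟨C, hBC, hC⟩ := zorn_le_nonempty₀ {C : Submodule R M | Disjoint A C}
    (fun c hc hchain y hy => ⟨sSup c, (hchain.directedOn.disjoint_sSup_right).2 fun b hb => hc hb,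
      fun z hz => le_sSup hz⟩) B h
  exact ⟨C, hBC, hC.prop, fun D hCD hD => hC.le_of_ge hD hCD⟩

/-- Every submodule of an injective module is essential in some direct summand. -/
theorem Module.Injective.exists_essential_summand (h : Module.Injective R M) (A : Submodule R M) :
    ∃ E C : Submodule R M, A ≤ E ∧ IsCompl E C ∧ ∀ N ≤ E, Disjoint N A → N = ⊥ := by
  -- `C` is maximal disjoint from `A`, then `E ⊇ A` maximal disjoint from `C`: maximality of `C`
  -- makes `A` essential in `E`.
  obtain ⟨C, -, hAC, hCmax⟩ := Submodule.exists_le_maximal_disjoint (disjoint_bot_right (a := A))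
  obtain ⟨E, hAE, hCE, hEmax⟩ := Submodule.exists_le_maximal_disjoint hAC.symm
  have hess : ∀ N ≤ E, Disjoint N A → N = ⊥ := fun N hN hNA => by
    have hle : C ⊔ N ≤ C := hCmax _ le_sup_left (by
      refine Submodule.disjoint_def.2 fun a ha hcn => ?_
      obtain ⟨c, hc, n, hn, rfl⟩ := Submodule.mem_sup.1 hcn
      have hcE : c ∈ E := by
        have := E.sub_mem (hAE ha) (hN hn)
        rwa [add_sub_cancel_right] at this
      have hc0 : c = 0 := Submodule.disjoint_def.1 hCE c hc hcE
      rw [hc0, zero_add] at ha ⊢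
      exact Submodule.disjoint_def.1 hNA n hn ha)
    exact le_bot_iff.1 (hCE (le_sup_right.trans hle) hN)
  refine ⟨E, C, hAE, ⟨hCE.symm, codisjoint_iff.2 ?_⟩, hess⟩
  -- To see `E + C = M`, extend the inclusion of `E` along `E → M/C` to `g`. Once `g` has range in
  -- `E`, `a ↦ g (C.mkQ a)` is a projection onto `E` along `C`.
  let f : E →ₗ[R] M ⧸ C := C.mkQ ∘ₗ E.subtype
  have hf : Function.Injective f := (injective_iff_map_eq_zero _).2 fun a ha =>
    Subtype.ext (Submodule.disjoint_def.1 hCE _ ((Submodule.Quotient.mk_eq_zero C).1 ha) a.2)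
  obtain ⟨g, hg⟩ := h.out f hf E.subtype
  -- The map `g` is injective, since the image of `E` is essential in `M ⧸ C`.
  have hker : (LinearMap.ker g).comap C.mkQ ≤ C := by
    refine hCmax _ (fun c hc => ?_) (Submodule.disjoint_def.2 fun a ha hga => ?_)
    · rw [Submodule.mem_comap, Submodule.mkQ_apply, (Submodule.Quotient.mk_eq_zero C).2 hc]
      exact zero_mem _
    · exact (hg ⟨a, hAE ha⟩).symm.trans hga
  have hrange : LinearMap.range g ≤ E := by
    refine hEmax _ (fun a ha => ⟨_, hg ⟨a, ha⟩⟩) (Submodule.disjoint_def.2 ?_)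
    rintro _ hgC ⟨b, rfl⟩
    -- The preimage of `C` under `g` meets the image of `E` trivially.
    have hle : (C.comap g).comap C.mkQ ≤ C := by
      refine hCmax _ (fun c hc => ?_) (Submodule.disjoint_def.2 fun a ha hga => ?_)
      · rw [Submodule.mem_comap, Submodule.mkQ_apply, (Submodule.Quotient.mk_eq_zero C).2 hc]
        exact zero_mem _
      · have hgaC : g (C.mkQ a) ∈ C := hga
        rw [show g (C.mkQ a) = a from hg ⟨a, hAE ha⟩] at hgaC
        exact Submodule.disjoint_def.1 hAC a ha hgaC
    obtain ⟨b, rfl⟩ := C.mkQ_surjective b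
    rw [Submodule.mkQ_apply, (Submodule.Quotient.mk_eq_zero C).2 (hle hgC), map_zero]
  refine top_le_iff.1 fun a _ => ?_
  have hga : g (C.mkQ a) ∈ E := hrange ⟨_, rfl⟩
  have hdiff : a - g (C.mkQ a) ∈ C := hker (by
    rw [Submodule.mem_comap, LinearMap.mem_ker, map_sub, map_sub, sub_eq_zero]
    exact (hg ⟨_, hga⟩).symm)
  rw [← add_sub_cancel (g (C.mkQ a)) a]
  exact Submodule.add_mem_sup hga hdiff

theorem Module.Injective.exists_isInjectiveHull {K : Type u} [AddCommGroup K] [Module R K]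
    (h : Module.Injective R M) (i : K →ₗ[R] M) (hi : Function.Injective i) :
    ∃ E : Submodule R M, IsInjectiveHull R K E := by
  obtain ⟨E, C, hle, hcompl, hess⟩ := h.exists_essential_summand (LinearMap.range i)
  refine ⟨E, h.of_isCompl hcompl, i.codRestrict E fun k => hle ⟨k, rfl⟩,
    fun a b hab => hi (congrArg Subtype.val hab), fun N hN => ?_⟩
  have := hess (N.map E.subtype) (Submodule.map_subtype_le _ _) (Submodule.disjoint_def.2 ?_)
  · exact Submodule.map_injective_of_injective E.injective_subtype
      (this.trans (Submodule.map_bot _).symm)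
  · rintro _ ⟨n, hn, rfl⟩ ⟨k, hk⟩
    have : n ∈ N ⊓ LinearMap.range (i.codRestrict E fun k => hle ⟨k, rfl⟩) :=
      ⟨hn, k, Subtype.ext hk⟩
    rw [hN, Submodule.mem_bot] at this
    rw [this, map_zero]

/-- An extension of `i'` along `i` is injective by essentiality in `E`; its range is a summand
containing the copy of `K`, so essentiality in `E'` kills the complement. -/
theorem IsInjectiveHull.nonempty_linearEquiv {K E E' : Type u} [AddCommGroup K] [Module R K]
    [AddCommGroup E] [Module R E] [AddCommGroup E'] [Module R E']
    (h : IsInjectiveHull R K E) (h' : IsInjectiveHull R K E') : Nonempty (E ≃ₗ[R] E') := by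
  obtain ⟨hinj, i, hi, hess⟩ := h
  obtain ⟨hinj', i', hi', hess'⟩ := h'
  obtain ⟨f, hf⟩ := hinj'.out i hi i'
  have hfinj : Function.Injective f := LinearMap.ker_eq_bot.1 (hess _
    ((Submodule.eq_bot_iff _).2 fun a ha => by
      obtain ⟨ha, k, rfl⟩ := ha
      have hk : i' k = i' 0 := by rw [← hf, map_zero]; exact ha
      rw [hi' hk, map_zero]))
  obtain ⟨C, hC⟩ := hinj.exists_isCompl_range f hfinj
  have hC0 : C = ⊥ := hess' C (le_bot_iff.1 (by
    rw [inf_comm, ← hC.inf_eq_bot]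
    refine inf_le_inf_right C ?_
    rintro _ ⟨k, rfl⟩
    exact ⟨i k, hf k⟩))
  refine ⟨LinearEquiv.ofBijective f ⟨hfinj, LinearMap.range_eq_top.1 ?_⟩⟩
  rw [← hC.sup_eq_top, hC0, sup_bot_eq]

lemma DirectSum.exists_finset_forall_apply_eq_zero {ι : Type*} {Q : ι → Type*}
    [∀ i, AddCommGroup (Q i)] [∀ i, Module R (Q i)] (N : Submodule R (⨁ i, Q i)) (hN : N.FG) :
    ∃ s : Finset ι, ∀ a ∈ N, ∀ i ∉ s, a i = 0 := by
  classical
  obtain ⟨t, rfl⟩ := hN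
  refine ⟨t.biUnion fun a => DFinsupp.support a, fun a ha i hi => ?_⟩
  induction ha using Submodule.span_induction with
  | mem a h => exact DFinsupp.notMem_support_iff.1 fun h' => hi (Finset.mem_biUnion.2 ⟨a, h, h'⟩)
  | zero => rfl
  | add a b _ _ ha hb => rw [DirectSum.add_apply, ha, hb, add_zero]
  | smul r a _ ha => rw [DirectSum.smul_apply, ha, smul_zero]

/-- Over a Noetherian ring, direct sums of injective modules are injective. -/
theorem DirectSum.injective [IsNoetherianRing R] {ι : Type u} (Q : ι → Type u)
    [∀ i, AddCommGroup (Q i)] [∀ i, Module R (Q i)] (h : ∀ i, Module.Injective R (Q i)) :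
    Module.Injective R (⨁ i, Q i) := by
  classical
  refine Module.Baer.injective fun I g => ?_
  -- Baer's criterion: the ideal is finitely generated, so `g` meets only finitely many summands,
  -- where it extends componentwise.
  obtain ⟨s, hs⟩ := DirectSum.exists_finset_forall_apply_eq_zero (LinearMap.range g)
    (by rw [LinearMap.range_eq_map]; exact (IsNoetherian.noetherian (⊤ : Submodule R I)).map g)
  choose k hk using fun i => Module.Baer.of_injective (h i) I (DirectSum.component R ι Q i ∘ₗ g)
  let m : ⨁ i, Q i := DFinsupp.mk s fun i => k i 1
  refine ⟨LinearMap.toSpanSingleton R _ m, fun r hr => DFinsupp.ext fun i => ?_⟩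
  change r • m i = g ⟨r, hr⟩ i
  by_cases hi : i ∈ s
  · have h1 : m i = k i 1 := DFinsupp.mk_of_mem hi
    rw [h1, ← map_smul, smul_eq_mul, mul_one, hk i r hr]
    rfl
  · have h1 : m i = 0 := DFinsupp.mk_of_notMem hi
    rw [h1, smul_zero, hs _ ⟨_, rfl⟩ i hi]

lemma sSupIndep.insert {α : Type*} [CompleteLattice α] [IsModularLattice α] {t : Set α} {a : α}
    (ht : sSupIndep t) (ha : Disjoint a (sSup t)) : sSupIndep (insert a t) := by
  by_cases hat : a ∈ t
  · rwa [Set.insert_eq_of_mem hat]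
  rintro b (rfl | hb)
  · rwa [Set.insert_sdiff_of_mem _ (Set.mem_singleton _), Set.sdiff_singleton_eq_self hat]
  · have hab : a ∉ ({b} : Set α) := fun h => hat (Set.mem_singleton_iff.1 h ▸ hb)
    rw [Set.insert_sdiff_of_notMem _ hab, sSup_insert, sup_comm]
    refine (ht hb).disjoint_sup_right_of_disjoint_sup_left (ha.symm.mono_left ?_)
    exact sup_le (le_sSup hb) (sSup_le_sSup Set.sdiff_subset)

/-- **Matlis**: an injective module over a Noetherian ring is a direct sum of injective hulls of
residue class domains. -/
theorem Module.Injective.exists_directSum [IsNoetherianRing R] (h : Module.Injective R M) :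
    ∃ (ι : Type u) (P : ι → PrimeSpectrum R) (N : ι → Submodule R M),
      (∀ i, IsInjectiveHull R (R ⧸ (P i).asIdeal) (N i)) ∧ Nonempty (M ≃ₗ[R] ⨁ i, N i) := by
  classical
  -- Take a maximal independent family of hulls. Its sum is injective, hence a summand; an
  -- associated prime of a nonzero complement would supply one more hull.
  let S : Set (Submodule R M) := {N | ∃ P : PrimeSpectrum R, IsInjectiveHull R (R ⧸ P.asIdeal) N}
  obtain ⟨t, ht⟩ := zorn_subset {t : Set (Submodule R M) | t ⊆ S ∧ sSupIndep t} fun c hc hchain =>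
    ⟨⋃₀ c, ⟨Set.sUnion_subset fun s hs => (hc hs).1,
      iSupIndep_sUnion_of_directed hchain.directedOn fun s hs => (hc hs).2⟩,
      fun s hs => Set.subset_sUnion_of_mem hs⟩
  choose P hP using fun N : t => ht.prop.1 N.2
  have hind : iSupIndep fun N : t => (N : Submodule R M) := (sSupIndep_iff t).1 ht.prop.2
  let f : (⨁ N : t, (N : Submodule R M)) →ₗ[R] M := DirectSum.coeLinearMap fun N : t => N.1
  have hf : Function.Injective f := hind.dfinsupp_lsum_injective
  have hrange : LinearMap.range f = sSup t := by
    rw [DirectSum.range_coeLinearMap, sSup_eq_iSup']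
  obtain ⟨C, hC⟩ := (DirectSum.injective (fun N : t => (N : Submodule R M))
    fun N => (hP N).1).exists_isCompl_range f hf
  have hCinj := h.of_isCompl hC.symm
  have hC0 : C = ⊥ := by
    by_contra hne
    have := Submodule.nontrivial_iff_ne_bot.2 hne
    obtain ⟨p, hp⟩ := associatedPrimes.nonempty R C
    obtain ⟨hpp, i, hi⟩ := (isAssociatedPrime_iff_exists_injective_linearMap _ _).1 hp
    obtain ⟨E, hE⟩ := hCinj.exists_isInjectiveHull i hi
    have hE' : IsInjectiveHull R (R ⧸ p) (E.map C.subtype) :=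
      hE.of_linearEquiv (Submodule.equivSubtypeMap C E)
    have hle : E.map C.subtype ≤ C := Submodule.map_subtype_le _ _
    have hmem : E.map C.subtype ∈ t := ht.mem_of_prop_insert ⟨Set.insert_subset
      ⟨⟨p, hpp⟩, hE'⟩ ht.prop.1, ht.prop.2.insert (hC.disjoint.symm.mono_left hle |>.mono_right
        hrange.ge)⟩
    have hbot : E.map C.subtype = ⊥ := le_bot_iff.1
      (hC.disjoint ((le_sSup hmem).trans hrange.ge) hle)
    obtain ⟨-, j, hj, -⟩ := hE'
    have := Submodule.subsingleton_iff_eq_bot.2 hbot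
    have : Subsingleton (R ⧸ p) := hj.subsingleton
    exact hpp.ne_top (Ideal.Quotient.subsingleton_iff.1 this)
  refine ⟨t, P, fun N => N, hP, ⟨(LinearEquiv.ofBijective f ⟨hf, LinearMap.range_eq_top.1 ?_⟩).symm⟩⟩
  rw [← hC.sup_eq_top, hC0, sup_bot_eq]

end Matlis

/-! ### Splitting direct sums. -/

section DirectSumLemmas

variable {R : Type*} [Ring R] {ι : Type*} (Q : ι → Type*) [∀ i, AddCommGroup (Q i)]
  [∀ i, Module R (Q i)]

/-- A direct sum splits along a partition of the index set. -/
noncomputable def DirectSum.linearEquivSubtypeProd (P : ι → Prop) :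
    (⨁ i, Q i) ≃ₗ[R] (⨁ i : {i // P i}, Q i) × (⨁ i : {i // ¬ P i}, Q i) := by
  classical
  let F : (⨁ i, Q i) →ₗ[R] (⨁ i : {i // P i}, Q i) × (⨁ i : {i // ¬ P i}, Q i) :=
    (DFinsupp.subtypeDomainLinearMap R Q P).prod (DFinsupp.subtypeDomainLinearMap R Q fun i => ¬ P i)
  refine LinearEquiv.ofBijective F ⟨?_, ?_⟩
  · refine (injective_iff_map_eq_zero _).2 fun a ha => DFinsupp.ext fun i => ?_
    by_cases hi : P i
    · exact DFunLike.congr_fun (congrArg Prod.fst ha) (⟨i, hi⟩ : {i // P i})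
    · exact DFunLike.congr_fun (congrArg Prod.snd ha) (⟨i, hi⟩ : {i // ¬ P i})
  · have h1 : ∀ (T : ι → Prop) [DecidablePred T] (i : {i // T i}) (a : Q i),
        DFinsupp.subtypeDomain T (DirectSum.of Q i a) =
          DirectSum.of (fun i : {i // T i} => Q i) i a := fun T _ i a => DFinsupp.ext fun j => by
      rw [DFinsupp.subtypeDomain_apply]
      by_cases hij : j = i
      · subst hij; rw [DirectSum.of_eq_same, DirectSum.of_eq_same]
      · rw [DirectSum.of_eq_of_ne _ _ _ hij,
          DirectSum.of_eq_of_ne _ _ _ fun h => hij (Subtype.ext h)]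
    have h2 : ∀ (T T' : ι → Prop) [DecidablePred T'] (i : {i // T i}) (a : Q i),
        (∀ i, T' i → ¬ T i) → DFinsupp.subtypeDomain T' (DirectSum.of Q i a) = 0 :=
      fun T T' _ i a h => DFinsupp.ext fun j => by
        rw [DFinsupp.subtypeDomain_apply, DFinsupp.zero_apply]
        exact DirectSum.of_eq_of_ne _ _ _ fun hji => h j j.2 (hji ▸ i.2)
    have h3 : ∀ a : ⨁ i : {i // P i}, Q i, (a, 0) ∈ LinearMap.range F := fun a => by
      induction a using DirectSum.induction_on with
      | zero => exact zero_mem _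
      | of i a =>
        refine ⟨DirectSum.of Q i a, Prod.ext (h1 P i a) ?_⟩
        exact h2 P (fun i => ¬ P i) i a fun _ h => h
      | add a a' ha ha' => simpa only [Prod.mk_add_mk, add_zero] using add_mem ha ha'
    have h4 : ∀ b : ⨁ i : {i // ¬ P i}, Q i, (0, b) ∈ LinearMap.range F := fun b => by
      induction b using DirectSum.induction_on with
      | zero => exact zero_mem _
      | of i b =>
        refine ⟨DirectSum.of Q i b, Prod.ext ?_ (h1 (fun i => ¬ P i) i b)⟩
        exact h2 (fun i => ¬ P i) P i b fun _ h h' => h' h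
      | add b b' hb hb' => simpa only [Prod.mk_add_mk, add_zero] using add_mem hb hb'
    rintro ⟨a, b⟩
    have := add_mem (h3 a) (h4 b)
    rwa [Prod.mk_add_mk, add_zero, zero_add] at this

end DirectSumLemmas

/-! ### Dimension of the dual of a field extension. -/

section RankDual

open Cardinal in
/-- A form of the Erdős–Kaplansky theorem: the multiplicity `c` of a `K`-algebra `L` in its
`K`-dual is finite only if `L` is finite over `K`, and then it is one. -/
theorem Module.finite_iff_of_rank_mul_eq_rank_dual {K L Γ : Type u} [Field K] [CommRing L]
    [Nontrivial L] [Algebra K L] (h : Module.rank K L * #Γ = Module.rank K (L →ₗ[K] K)) :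
    Nonempty Γ ∧ (Finite Γ ↔ Module.Finite K L) ∧ (Finite Γ → Nat.card Γ = 1) := by
  by_cases hfin : Module.Finite K L
  · have hn : 0 < Module.finrank K L := Module.finrank_pos
    rw [← Module.finrank_eq_rank, ← Module.finrank_eq_rank, show Module.finrank K (L →ₗ[K] K) =
      Module.finrank K L from Subspace.dual_finrank_eq] at h
    have hle : #Γ ≤ Module.finrank K L := by
      conv_rhs => rw [← h]
      exact Cardinal.le_mul_left (by exact_mod_cast hn.ne')
    have hΓ : Finite Γ := Cardinal.lt_aleph0_iff_finite.1 (hle.trans_lt natCast_lt_aleph0)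
    have hcard : Nat.card Γ = 1 := by
      rw [← Nat.cast_card] at h
      exact Nat.eq_of_mul_eq_mul_left hn (by rw [mul_one]; exact_mod_cast h)
    exact ⟨(Nat.card_pos_iff.1 (by omega)).1, ⟨fun _ => hfin, fun _ => hΓ⟩, fun _ => hcard⟩
  · have hinf : ℵ₀ ≤ Module.rank K L := by
      rw [← not_lt, Module.rank_lt_aleph0_iff]
      exact hfin
    have hlt := _root_.rank_lt_rank_dual hinf
    -- A finite `Γ` would give `dim L* = dim L · #Γ ≤ dim L`, contradicting the strict growth of
    -- infinite-dimensional duals.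
    have hΓ : ¬ Finite Γ := fun hΓ => by
      rw [← h] at hlt
      refine absurd hlt (not_lt.2 ?_)
      calc Module.rank K L * #Γ ≤ Module.rank K L * Module.rank K L := by
            gcongr
            exact (Cardinal.lt_aleph0_of_finite Γ).le.trans hinf
        _ = Module.rank K L := Cardinal.mul_eq_self hinf
    refine ⟨?_, ⟨fun h' => absurd h' hΓ, fun h' => absurd h' hfin⟩, fun h' => absurd h' hΓ⟩
    by_contra hne
    rw [not_nonempty_iff] at hne
    exact hΓ inferInstance

end RankDual

/-! ### Injectivity and decomposition of `Hom(ᶠR, E)`. -/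

section FrobHomInjective

variable (p : ℕ) {R : Type u} [CommRing R] [ExpChar R p]

lemma FrobHom.ext {M : Type*} [AddCommGroup M] [Module R M] {φ ψ : FrobHom p R M}
    (h : ∀ s, φ s = ψ s) : φ = ψ := LinearMap.ext h

variable {M : Type*} [AddCommGroup M] [Module R M]

lemma FrobHom.map_smul_eq (φ : FrobHom p R M) (r : R) (s : FrobRing p R) :
    φ (toFrobRing p (r ^ p) * s) = r • φ s :=
  LinearMap.map_smul (show FrobRing p R →ₗ[R] M from φ) r s

lemma FrobHom.apply_add (φ : FrobHom p R M) (s t : FrobRing p R) : φ (s + t) = φ s + φ t :=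
  LinearMap.map_add (show FrobRing p R →ₗ[R] M from φ) s t

lemma FrobHom.add_apply (φ ψ : FrobHom p R M) (s : FrobRing p R) : (φ + ψ) s = φ s + ψ s := rfl

lemma FrobHom.zero_apply (s : FrobRing p R) : (0 : FrobHom p R M) s = 0 := rfl

/-- Coinduction is right adjoint to restriction of scalars: evaluating at `1` turns an `ᶠR`-map `I →
Hom(ᶠR, E)` into an `R`-map `I → E`, which extends to `ᶠR`. -/
theorem FrobHom.baer {E : Type u} [AddCommGroup E] [Module R E] (hE : Module.Injective R E) :
    Module.Baer (FrobRing p R) (FrobHom p R E) := by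
  intro I g
  let g' : I →ₗ[R] E :=
    { toFun := fun a => g a 1
      map_add' := fun a b => by rw [map_add, FrobHom.add_apply]
      map_smul' := fun r a => by
        have : r • a = toFrobRing p (r ^ p) • a := rfl
        rw [this, map_smul, FrobHom.smul_apply, FrobHom.map_smul_eq, RingHom.id_apply] }
  obtain ⟨h, hh⟩ := hE.out (I.subtype.restrictScalars R) I.injective_subtype g'
  refine ⟨LinearMap.toSpanSingleton (FrobRing p R) (FrobHom p R E) h, fun s hs => ?_⟩
  refine FrobHom.ext p fun t => ?_
  have h1 : h (s * t) = g (⟨s * t, I.mul_mem_right t hs⟩ : I) 1 := hh ⟨s * t, _⟩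
  have h2 : (⟨s * t, I.mul_mem_right t hs⟩ : I) = t • ⟨s, hs⟩ := Subtype.ext (mul_comm s t)
  rw [h2, map_smul, FrobHom.smul_apply, mul_one] at h1
  exact h1

theorem FrobHom.injective {E : Type u} [AddCommGroup E] [Module R E] (hE : Module.Injective R E) :
    Module.Injective (FrobRing p R) (FrobHom p R E) :=
  @Module.Baer.injective (FrobRing p R) _ (FrobHom p R E) _ _ (FrobHom.baer p hE)

/-- A direct sum of Frobenius twists. -/
noncomputable def directSumFrobMod {ι : Type*} (Q : ι → Type*) [∀ i, AddCommGroup (Q i)] :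
    (⨁ i, Q i) ≃+ ⨁ i, FrobMod p (Q i) :=
  DFinsupp.mapRange.addEquiv fun _ => toFrobMod p

omit [ExpChar R p] in
lemma directSumFrobMod_smul {ι : Type*} (Q : ι → Type*) [∀ i, AddCommGroup (Q i)]
    [∀ i, Module R (Q i)] (r : R) (a : ⨁ i, Q i) :
    directSumFrobMod p Q (r • a) = toFrobRing p r • directSumFrobMod p Q a :=
  DFinsupp.ext fun _ => rfl

theorem FrobHom.exists_decomposition [IsLocalRing R] [IsNoetherianRing R] {E : Type u}
    [AddCommGroup E] [Module R E] (hE : IsInjectiveHull R (ResidueField R) E) :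
    ∃ (Γ Λ : Type u) (P : Λ → PrimeSpectrum R) (Q : Λ → Type u)
      (_ : ∀ l, AddCommGroup (Q l)) (_ : ∀ l, Module R (Q l)),
      (∀ l, (P l).asIdeal ≠ maximalIdeal R) ∧
      (∀ l, IsInjectiveHull R (R ⧸ (P l).asIdeal) (Q l)) ∧
      Nonempty (FrobHom p R E ≃ₗ[FrobRing p R]
        (⨁ _ : Γ, FrobMod p E) × (⨁ l, FrobMod p (Q l))) := by
  -- Here `R` acts through the identity `R ≃ ᶠR`, not through Frobenius; this lets Matlis' theorem
  -- be applied over `R` and the result be transported back.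
  let : Module R (FrobHom p R E) := Module.compHom _ (toFrobRing p : R ≃+* FrobRing p R).toRingHom
  have hinj : Module.Injective R (FrobHom p R E) := FrobHom.injective p hE.1
  obtain ⟨ι, P, N, hN, ⟨e⟩⟩ := hinj.exists_directSum
  let e1 := e.trans (DirectSum.linearEquivSubtypeProd (fun i => N i)
    fun i => (P i).asIdeal = maximalIdeal R)
  have hNE : ∀ i : {i // (P i).asIdeal = maximalIdeal R}, Nonempty (N i ≃ₗ[R] E) := fun i => by
    have h := hN i
    rw [i.2] at h
    exact h.nonempty_linearEquiv hE
  let e2 : (⨁ i : {i // (P i).asIdeal = maximalIdeal R}, N i) ≃ₗ[R]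
      ⨁ _ : {i // (P i).asIdeal = maximalIdeal R}, E :=
    DFinsupp.mapRange.linearEquiv fun i => (hNE i).some
  let e3 := e1.trans (e2.prodCongr (LinearEquiv.refl R _))
  let e4 := e3.toAddEquiv.trans ((directSumFrobMod p _).prodCongr (directSumFrobMod p _))
  refine ⟨{i // (P i).asIdeal = maximalIdeal R}, {i // ¬ (P i).asIdeal = maximalIdeal R},
    fun i => P i, fun i => N i, inferInstance, inferInstance, fun i => i.2, fun i => hN i,
    ⟨{ e4 with map_smul' := fun s a => ?_ }⟩⟩
  obtain ⟨r, rfl⟩ := (toFrobRing p).surjective s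
  have h1 : e3 (toFrobRing p r • a) = r • e3 a := e3.map_smul r a
  refine (congrArg ((directSumFrobMod p _).prodCongr (directSumFrobMod p _)) h1).trans ?_
  exact Prod.ext (directSumFrobMod_smul p (fun _ => E) r (e3 a).1)
    (directSumFrobMod_smul p (fun i : {i // ¬ (P i).asIdeal = maximalIdeal R} => N i) r (e3 a).2)

end FrobHomInjective

/-! ### Semilinear maps on `E`, and the isomorphism `Ψ`. -/

section Frobenius

variable {R : Type u} [CommRing R] {E : Type u} [AddCommGroup E] [Module R E]

/-- A nonzero such element would yield, by essentiality, a nonzero element of the domain `R/P`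
killed by `𝔪`, forcing `𝔪 ≤ P`. -/
lemma IsInjectiveHull.eq_zero_of_pow_smul_eq_zero [IsLocalRing R] {P : PrimeSpectrum R}
    (hP : P.asIdeal ≠ maximalIdeal R) (hE : IsInjectiveHull R (R ⧸ P.asIdeal) E) {a : E} {k : ℕ}
    (h : ∀ r ∈ maximalIdeal R ^ k, r • a = 0) : a = 0 := by
  by_contra ha
  obtain ⟨r, hr0, hr⟩ := exists_smul_ne_zero_of_pow_smul_eq_zero ha h
  obtain ⟨-, i, hi, hess⟩ := hE
  have hne : Submodule.span R {r • a} ⊓ LinearMap.range i ≠ ⊥ := fun h =>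
    hr0 (Submodule.span_singleton_eq_bot.1 (hess _ h))
  obtain ⟨b, ⟨hb, c, rfl⟩, hb0⟩ := Submodule.exists_mem_ne_zero_of_ne_bot hne
  obtain ⟨t, ht⟩ := Submodule.mem_span_singleton.1 hb
  obtain ⟨s, rfl⟩ := Ideal.Quotient.mk_surjective c
  refine hP (le_antisymm (le_maximalIdeal P.2.ne_top) fun m hm => ?_)
  have h1 : i (Ideal.Quotient.mk P.asIdeal (m * s)) = 0 := by
    rw [map_mul, ← Ideal.Quotient.algebraMap_eq, ← Algebra.smul_def, map_smul,
      Ideal.Quotient.algebraMap_eq, ← ht, smul_comm, hr m hm, smul_zero]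
  rw [map_eq_zero_iff i hi, Ideal.Quotient.eq_zero_iff_mem] at h1
  refine (P.2.mem_or_mem h1).resolve_right fun hs => hb0 ?_
  rw [Ideal.Quotient.eq_zero_iff_mem.2 hs, map_zero]

lemma IsRegularLocalRing.exists_span_range_eq (R : Type*) [CommRing R] [IsRegularLocalRing R] :
    ∃ (d : ℕ) (x : Fin d → R), d = (maximalIdeal R).spanFinrank ∧
      Ideal.span (Set.range x) = maximalIdeal R := by
  obtain ⟨g, hg, hgs⟩ := Submodule.FG.exists_span_finset_card_eq_spanFinrank
    (maximalIdeal R).fg_of_isNoetherianRing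
  refine ⟨g.card, fun i => g.equivFin.symm i, hg, ?_⟩
  rw [← hgs, Set.range_comp' Subtype.val, g.equivFin.symm.surjective.range_eq, Set.image_univ,
    Subtype.range_coe]

/-- Endomorphisms of the injective hull of the residue field are multiplications. -/
theorem IsInjectiveHull.existsUnique_eq_smul [IsRegularLocalRing R]
    [IsAdicComplete (maximalIdeal R) R] (hE : IsInjectiveHull R (ResidueField R) E)
    (g : E →ₗ[R] E) : ∃! r : R, ∀ a, g a = r • a := by
  obtain ⟨d, x, hd, hspan⟩ := IsRegularLocalRing.exists_span_range_eq R
  have hx := IsRegularLocalRing.isPermutableRegular ((Fintype.card_fin d).trans hd) hspan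
  obtain ⟨θ⟩ := InversePolynomials.nonempty_linearEquiv hspan hx hE
  -- The case `q = 1`, with the identity in the role of the Frobenius map.
  have key := InversePolynomials.existsUnique_eq_smul hspan hx (q := 1) le_rfl (AddMonoidHom.id _)
    (θ.toLinearMap ∘ₗ g ∘ₗ θ.symm.toLinearMap).toAddMonoidHom
    (fun r a => by rw [pow_one]; rfl) (fun n => by rw [one_mul]; rfl)
    (fun r a => by rw [pow_one]; exact (θ.toLinearMap ∘ₗ g ∘ₗ θ.symm.toLinearMap).map_smul r a)
  have hiff : ∀ r : R, (∀ a, (θ.toLinearMap ∘ₗ g ∘ₗ θ.symm.toLinearMap).toAddMonoidHom a =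
      r • AddMonoidHom.id _ a) ↔ ∀ a, g a = r • a := fun r => by
    constructor
    · intro h a
      have := h (θ a)
      apply θ.injective
      rw [map_smul]
      simpa using this
    · intro h a
      change θ (g (θ.symm a)) = r • a
      rw [h, map_smul, θ.apply_symm_apply]
  simpa only [hiff] using key

variable (p : ℕ)

/-- On the injective hull of the residue field, every Frobenius semilinear map is a unique multiple
of the standard Frobenius map. -/
theorem InversePolynomials.existsUnique_eq_smul_frobenius [ExpChar R p] [IsLocalRing R]
    [IsAdicComplete (maximalIdeal R) R] {d : ℕ} {x : Fin d → R}
    (hspan : Ideal.span (Set.range x) = maximalIdeal R) (hx : IsPermutableRegular x)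
    (θ : E ≃ₗ[R] InversePolynomials x) (g : E →ₗ[R] FrobMod p E) :
    ∃! r : FrobRing p R, r • InversePolynomials.frobenius p x θ = g := by
  have key := InversePolynomials.existsUnique_eq_smul hspan hx (q := p) (expChar_pos R p)
    ((toFrobMod p).symm.toAddMonoidHom.comp (InversePolynomials.T p x).toAddMonoidHom)
    (θ.toLinearMap.toAddMonoidHom.comp ((toFrobMod p).symm.toAddMonoidHom.comp
      (g.toAddMonoidHom.comp θ.symm.toLinearMap.toAddMonoidHom)))
    (fun r a => congrArg (toFrobMod p).symm ((InversePolynomials.T p x).map_smul r a))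
    (fun n => by
      have := T_smul_monomial p x 1 (fun _ => n)
      rw [one_smul, one_pow, one_smul] at this
      exact congrArg (toFrobMod p).symm this)
    (fun r a => by
      have h1 : g (θ.symm (r • a)) = r • g (θ.symm a) := by rw [map_smul, map_smul]
      have h2 := congrArg (fun b => θ ((toFrobMod p).symm b)) h1
      exact h2.trans (θ.map_smul (r ^ p) ((toFrobMod p).symm (g (θ.symm a)))))
  obtain ⟨r, hr, huniq⟩ := key
  have hF : ∀ (s : R) (a : E), (toFrobRing p s • InversePolynomials.frobenius p x θ) a =
      toFrobMod p (θ.symm (s • (toFrobMod p).symm (T p x (θ a)))) := fun s a => by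
    rw [map_smul]; rfl
  refine ⟨toFrobRing p r, LinearMap.ext fun a => ?_, fun s hs => ?_⟩
  · rw [hF]
    have h := hr (θ a)
    refine (congrArg (fun b => toFrobMod p (θ.symm b)) h.symm).trans ?_
    change toFrobMod p (θ.symm (θ ((toFrobMod p).symm (g (θ.symm (θ a)))))) = g a
    rw [θ.symm_apply_apply, θ.symm_apply_apply, AddEquiv.apply_symm_apply]
  · obtain ⟨s, rfl⟩ := (toFrobRing p).surjective s
    refine congrArg (toFrobRing p) (huniq s fun a => ?_)
    have h := hF s (θ.symm a)
    rw [hs, θ.apply_symm_apply] at h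
    change θ ((toFrobMod p).symm (g (θ.symm a))) = _
    rw [h, AddEquiv.symm_apply_apply, θ.apply_symm_apply]
    rfl

variable [ExpChar R p]

/-- The standard Frobenius map gives an isomorphism of `∏_γ ᶠR` with `∏_γ Hom_R(E, ᶠE)`. -/
theorem InversePolynomials.exists_pi_linearEquiv [IsLocalRing R]
    [IsAdicComplete (maximalIdeal R) R] {d : ℕ} {x : Fin d → R}
    (hspan : Ideal.span (Set.range x) = maximalIdeal R) (hx : IsPermutableRegular x)
    (θ : E ≃ₗ[R] InversePolynomials x) (Γ : Type*) :
    ∃ Φ : (Γ → FrobRing p R) ≃ₗ[FrobRing p R] (Γ → (E →ₗ[R] FrobMod p E)),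
      ∀ (r : Γ → FrobRing p R) (γ : Γ),
        Φ r γ = r γ • InversePolynomials.frobenius p x θ := by
  let F : FrobRing p R →ₗ[FrobRing p R] (E →ₗ[R] FrobMod p E) :=
    LinearMap.toSpanSingleton _ _ (InversePolynomials.frobenius p x θ)
  have hF : Function.Bijective F := (Function.bijective_iff_existsUnique _).2 fun g =>
    InversePolynomials.existsUnique_eq_smul_frobenius p hspan hx θ g
  exact ⟨LinearEquiv.piCongrRight fun _ => LinearEquiv.ofBijective F hF, fun _ _ => rfl⟩

lemma homComponents_injective (Γ : Type*) : Function.Injective (homComponents p R E Γ) :=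
  fun _ _ heq => LinearMap.ext fun a => DFinsupp.ext fun γ =>
    LinearMap.congr_fun (congrFun heq γ) a

lemma FrobHom.map_toSpanSingleton_smul (φ : FrobHom p R R) (r : R) (a : E) :
    FrobHom.map p (LinearMap.toSpanSingleton R E (r • a)) φ =
      algebraMap R (FrobRing p R) r • FrobHom.map p (LinearMap.toSpanSingleton R E a) φ :=
  FrobHom.ext p fun s => by
    rw [FrobHom.smul_apply, FrobHom.map_apply, FrobHom.map_apply, algebraMap_frobRing,
      FrobHom.map_smul_eq, LinearMap.toSpanSingleton_apply, LinearMap.toSpanSingleton_apply,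
      smul_smul, smul_eq_mul, mul_comm]

lemma FrobHom.map_toSpanSingleton_add (φ : FrobHom p R R) (a b : E) :
    FrobHom.map p (LinearMap.toSpanSingleton R E (a + b)) φ =
      FrobHom.map p (LinearMap.toSpanSingleton R E a) φ +
        FrobHom.map p (LinearMap.toSpanSingleton R E b) φ :=
  FrobHom.ext p fun s => smul_add (φ s) a b

/-- On this element `r ^ (k * p)` in `ᶠR` acts as `r ^ k` does on `a`, hence as zero; finite
generation of `𝔪` turns this into one power of `𝔪`. -/
lemma FrobHom.exists_pow_smul_map_eq_zero [IsLocalRing R] [IsNoetherianRing R]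
    (φ : FrobHom p R R) {a : E} {k : ℕ} (ha : ∀ r ∈ maximalIdeal R ^ k, r • a = 0) :
    ∃ n, ∀ r ∈ maximalIdeal R ^ n,
      toFrobRing p r • FrobHom.map p (LinearMap.toSpanSingleton R E a) φ = 0 := by
  let I : Ideal R := LinearMap.ker (LinearMap.toSpanSingleton (FrobRing p R) (FrobHom p R E)
    (FrobHom.map p (LinearMap.toSpanSingleton R E a) φ))
  refine Ideal.exists_pow_le_of_le_radical_of_fg (J := I) (fun r hr => ⟨k * p, ?_⟩)
    (maximalIdeal R).fg_of_isNoetherianRing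
  change toFrobRing p (r ^ (k * p)) • FrobHom.map p (LinearMap.toSpanSingleton R E a) φ = 0
  rw [pow_mul]
  refine FrobHom.ext p fun s => ?_
  rw [FrobHom.smul_apply, FrobHom.map_apply, FrobHom.map_smul_eq, LinearMap.toSpanSingleton_apply,
    smul_eq_mul, mul_comm, mul_smul, ha _ (Ideal.pow_mem_pow hr k), smul_zero]
  rfl

section Decomposition

variable {Γ Λ : Type u} {P : Λ → PrimeSpectrum R} {Q : Λ → Type u} [∀ l, AddCommGroup (Q l)]
  [∀ l, Module R (Q l)]

omit [ExpChar R p] in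
lemma directSum_frobMod_eq_zero [IsLocalRing R] (hP : ∀ l, (P l).asIdeal ≠ maximalIdeal R)
    (hQ : ∀ l, IsInjectiveHull R (R ⧸ (P l).asIdeal) (Q l)) (y : ⨁ l, FrobMod p (Q l)) {k : ℕ}
    (h : ∀ r ∈ maximalIdeal R ^ k, toFrobRing p r • y = 0) : y = 0 :=
  DFinsupp.ext fun l => (hQ l).eq_zero_of_pow_smul_eq_zero (hP l) (k := k) fun r hr =>
    DFunLike.congr_fun (h r hr) l

/-- `Ψ` is the first component of `D`; the second vanishes because the `𝔪`-power torsion does.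
Bijectivity uses `End(E) = R` for each `s ∈ ᶠR`. -/
theorem FrobHom.exists_linearEquiv_hom [IsRegularLocalRing R] [IsAdicComplete (maximalIdeal R) R]
    (hE : IsInjectiveHull R (ResidueField R) E)
    (hP : ∀ l, (P l).asIdeal ≠ maximalIdeal R)
    (hQ : ∀ l, IsInjectiveHull R (R ⧸ (P l).asIdeal) (Q l))
    (D : FrobHom p R E ≃ₗ[FrobRing p R] (⨁ _ : Γ, FrobMod p E) × (⨁ l, FrobMod p (Q l))) :
    ∃ Ψ : FrobHom p R R ≃ₗ[FrobRing p R] (E →ₗ[R] ⨁ _ : Γ, FrobMod p E),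
      ∀ (φ : FrobHom p R R) (a : E),
        D (FrobHom.map p (LinearMap.toSpanSingleton R E a) φ) = (Ψ φ a, 0) := by
  obtain ⟨w, hw⟩ := hE.exists_isSocleGenerator
  let Ψ : FrobHom p R R →ₗ[FrobRing p R] (E →ₗ[R] ⨁ _ : Γ, FrobMod p E) :=
    { toFun := fun φ =>
        { toFun := fun a => (D (FrobHom.map p (LinearMap.toSpanSingleton R E a) φ)).1
          map_add' := fun a b => by rw [FrobHom.map_toSpanSingleton_add, map_add, Prod.fst_add]
          map_smul' := fun r a => by
            rw [FrobHom.map_toSpanSingleton_smul, map_smul, Prod.smul_fst]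
            exact DFinsupp.ext fun _ => rfl }
      map_add' := fun φ ψ => LinearMap.ext fun a => by
        change (D _).1 = (D _).1 + (D _).1
        rw [map_add, map_add, Prod.fst_add]
      map_smul' := fun s φ => LinearMap.ext fun a => by
        change (D _).1 = s • (D _).1
        rw [map_smul, map_smul, Prod.smul_fst] }
  have hΨ : ∀ (φ : FrobHom p R R) (a : E),
      D (FrobHom.map p (LinearMap.toSpanSingleton R E a) φ) = (Ψ φ a, 0) := fun φ a => by
    refine Prod.ext rfl ?_
    obtain ⟨k, hk⟩ := hw.exists_pow_smul_eq_zero a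
    obtain ⟨n, hn⟩ := FrobHom.exists_pow_smul_map_eq_zero p φ hk
    refine directSum_frobMod_eq_zero p hP hQ _ (k := n) fun r hr => ?_
    rw [← Prod.smul_snd, ← map_smul, hn r hr, map_zero, Prod.snd_zero]
  refine ⟨LinearEquiv.ofBijective Ψ ⟨?_, fun h => ?_⟩, hΨ⟩
  · refine (injective_iff_map_eq_zero _).2 fun φ hφ => FrobHom.ext p fun s => ?_
    refine (hE.existsUnique_eq_smul 0).unique (fun a => ?_) fun a => (zero_smul R a).symm
    have := hΨ φ a
    rw [hφ, LinearMap.zero_apply, ← Prod.zero_eq_mk, LinearEquiv.map_eq_zero_iff] at this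
    exact (DFunLike.congr_fun this s).symm
  · have hsmul : ∀ (r : R) (a : E), D.symm (h (r • a), 0) =
        algebraMap R (FrobRing p R) r • D.symm (h a, 0) := fun r a => by
      refine (congrArg D.symm (Prod.ext ?_ (smul_zero _).symm)).trans
        (D.symm.map_smul (algebraMap R (FrobRing p R) r) (h a, 0))
      exact (h.map_smul r a).trans (DFinsupp.ext fun _ => rfl)
    have hadd : ∀ a b : E, D.symm (h (a + b), 0) = D.symm (h a, 0) + D.symm (h b, 0) := fun a b =>
      (congrArg D.symm (Prod.ext (h.map_add a b) (add_zero _).symm)).trans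
        (D.symm.map_add (h a, 0) (h b, 0))
    -- For fixed `s`, `a ↦ D⁻¹(h a, 0)(s)` is an endomorphism of `E`, hence multiplication by a
    -- unique `f s`; uniqueness makes `f` linear.
    let g : FrobRing p R → E →ₗ[R] E := fun s =>
      { toFun := fun a => D.symm (h a, 0) s
        map_add' := fun a b => by rw [hadd, FrobHom.add_apply]
        map_smul' := fun r a => by
          rw [hsmul, FrobHom.smul_apply, algebraMap_frobRing, FrobHom.map_smul_eq,
            RingHom.id_apply] }
    choose f hf huniq using fun s => hE.existsUnique_eq_smul (g s)
    dsimp only at hf huniq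
    let φ : FrobHom p R R := show FrobRing p R →ₗ[R] R from
      { toFun := f
        map_add' := fun s t => (huniq (s + t) _ fun a => by
          rw [add_smul, ← hf, ← hf]; exact FrobHom.apply_add p _ s t).symm
        map_smul' := fun r s => (huniq (r • s) _ fun a => by
          rw [RingHom.id_apply, smul_eq_mul, mul_smul, ← hf]
          exact FrobHom.map_smul_eq p _ r s).symm }
    refine ⟨φ, LinearMap.ext fun a => ?_⟩
    have h1 : FrobHom.map p (LinearMap.toSpanSingleton R E a) φ = D.symm (h a, 0) :=
      FrobHom.ext p fun s => (hf s a).symm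
    have h2 := hΨ φ a
    rw [h1, D.apply_symm_apply] at h2
    exact (congrArg Prod.fst h2).symm

end Decomposition

end Frobenius

/-! ### Socles and the number of copies of `ᶠE`. -/

section Socle

variable {R : Type u} [CommRing R] [IsLocalRing R] (p : ℕ) [Fact p.Prime] [CharP R p]
  {E : Type u} [AddCommGroup E] [Module R E]

/-- The residue map of `ᶠR`. -/
noncomputable def frobResidue (p : ℕ) : FrobRing p R →+* FrobRing p (ResidueField R) :=
  ((toFrobRing p).toRingHom.comp (residue R)).comp (toFrobRing p).symm.toRingHom

omit [Fact p.Prime] [CharP R p] in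
lemma frobResidue_surjective : Function.Surjective (frobResidue (R := R) p) :=
  residue_surjective (R := R)

/-- The map `Hom(ᶠ𝕂, 𝕂) → Hom(ᶠR, E)` given by the residue map and an element of the socle. -/
noncomputable def FrobHom.ofResidueField {w : E} (hw : ∀ r ∈ maximalIdeal R, r • w = 0) :
    FrobHom p (ResidueField R) (ResidueField R) →+ FrobHom p R E where
  toFun f := show FrobRing p R →ₗ[R] E from
    { toFun := fun s => residueLift w hw (f (frobResidue p s))
      map_add' := fun s t => by rw [map_add, FrobHom.apply_add, map_add]
      map_smul' := fun r s => by
        have h1 : frobResidue p (r • s) =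
            toFrobRing p (residue R r ^ p) * frobResidue p s := by
          rw [Algebra.smul_def, map_mul, algebraMap_frobRing]
          exact congrArg (· * _) (map_pow (residue R) r p)
        rw [h1, FrobHom.map_smul_eq]
        exact (residueLift w hw).map_smul r _ }
  map_zero' := FrobHom.ext p fun _ => (residueLift w hw).map_zero
  map_add' f g := FrobHom.ext p fun _ => (residueLift w hw).map_add _ _

variable {w : E}

lemma FrobHom.ofResidueField_apply (hw : ∀ r ∈ maximalIdeal R, r • w = 0)
    (f : FrobHom p (ResidueField R) (ResidueField R)) (s : FrobRing p R) :
    FrobHom.ofResidueField p hw f s = residueLift w hw (f (frobResidue p s)) := rfl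

lemma FrobHom.ofResidueField_smul (hw : ∀ r ∈ maximalIdeal R, r • w = 0)
    (f : FrobHom p (ResidueField R) (ResidueField R)) (s : FrobRing p R) :
    FrobHom.ofResidueField p hw (frobResidue p s • f) = s • FrobHom.ofResidueField p hw f :=
  FrobHom.ext p fun t => by
    rw [FrobHom.smul_apply, FrobHom.ofResidueField_apply, FrobHom.ofResidueField_apply, map_mul,
      FrobHom.smul_apply]

lemma FrobHom.ofResidueField_injective (hw : ∀ r ∈ maximalIdeal R, r • w = 0) (h0 : w ≠ 0) :
    Function.Injective (FrobHom.ofResidueField p hw) :=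
  fun f g hfg => FrobHom.ext p fun l => by
    obtain ⟨s, rfl⟩ := frobResidue_surjective p l
    exact residueLift_injective hw h0 (DFunLike.congr_fun hfg s)

lemma FrobHom.smul_ofResidueField (hw : ∀ r ∈ maximalIdeal R, r • w = 0)
    (f : FrobHom p (ResidueField R) (ResidueField R)) {r : R} (hr : r ∈ maximalIdeal R) :
    toFrobRing p r • FrobHom.ofResidueField p hw f = 0 := by
  have : frobResidue p (toFrobRing p r) = 0 := (residue_eq_zero_iff r).2 hr
  rw [← FrobHom.ofResidueField_smul, this, zero_smul, map_zero]

/-- The socle of `Hom(ᶠR, E)` is `Hom(ᶠ𝕂, 𝕂)`. -/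
lemma IsSocleGenerator.exists_ofResidueField_eq (hw : IsSocleGenerator (R := R) w)
    {v : FrobHom p R E} (hv : ∀ r ∈ maximalIdeal R, toFrobRing p r • v = 0) :
    ∃ f, FrobHom.ofResidueField p hw.smul_eq_zero f = v := by
  have hinj := residueLift_injective hw.smul_eq_zero hw.ne_zero
  -- The values of `v` are in the socle of `E`, since `r • v s = v (r ^ p * s) = 0` for `r ∈ 𝔪`.
  have h1 : ∀ s, ∃ c, residueLift w hw.smul_eq_zero c = v s := fun s => by
    obtain ⟨r, hr⟩ := hw.exists_eq_smul (a := v s) fun r hr => by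
      rw [← FrobHom.map_smul_eq, ← FrobHom.smul_apply,
        hv _ (Ideal.pow_mem_of_mem _ hr p (Fact.out : p.Prime).pos)]
      rfl
    exact ⟨residue R r, by rw [residueLift_residue, hr]⟩
  choose c hc using h1
  -- Being killed by `𝔪` also makes `v` factor through `ᶠ𝕂`.
  have hv0 : ∀ s t : FrobRing p R, frobResidue p s = frobResidue p t → v s = v t := fun s t h => by
    have hmem : (toFrobRing p).symm (s - t) ∈ maximalIdeal R :=
      (residue_eq_zero_iff _).1 (show frobResidue p (s - t) = 0 by rw [map_sub, h, sub_self])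
    have h2 := DFunLike.congr_fun (hv _ hmem) 1
    rw [RingEquiv.apply_symm_apply, FrobHom.smul_apply, mul_one, FrobHom.zero_apply] at h2
    rw [← sub_add_cancel s t, FrobHom.apply_add, h2, zero_add]
  choose lift hlift using frobResidue_surjective (R := R) p
  have hcl : ∀ s, residueLift w hw.smul_eq_zero (c (lift (frobResidue p s))) = v s := fun s => by
    rw [hc]
    exact hv0 _ _ (hlift _)
  refine ⟨show FrobRing p (ResidueField R) →ₗ[ResidueField R] ResidueField R from
    { toFun := fun l => c (lift l)
      map_add' := fun l m => ?_
      map_smul' := fun k l => ?_ }, FrobHom.ext p fun s => hcl s⟩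
  · obtain ⟨s, rfl⟩ := frobResidue_surjective p l
    obtain ⟨t, rfl⟩ := frobResidue_surjective p m
    apply hinj
    rw [← map_add, map_add (residueLift w _), hcl, hcl, hcl, FrobHom.apply_add]
  · obtain ⟨s, rfl⟩ := frobResidue_surjective p l
    obtain ⟨r, rfl⟩ := residue_surjective k
    apply hinj
    have h1 : residue R r • frobResidue p s = frobResidue p (toFrobRing p (r ^ p) * s) := by
      rw [map_mul, Algebra.smul_def, algebraMap_frobRing]
      exact congrArg (· * _) (map_pow (residue R) r p).symm
    have h2 : residue R r • c (lift (frobResidue p s)) = r • c (lift (frobResidue p s)) := rfl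
    rw [h1, hcl, FrobHom.map_smul_eq, RingHom.id_apply, h2, map_smul, hcl]

variable {Γ Λ : Type u} {P : Λ → PrimeSpectrum R} {Q : Λ → Type u} [∀ l, AddCommGroup (Q l)]
  [∀ l, Module R (Q l)]

/-- Comparing socles, the number of copies of `ᶠE` in `Hom(ᶠR, E)` is the `ᶠ𝕂`-dimension of
`Hom(ᶠ𝕂, 𝕂)`. -/
theorem FrobHom.nonempty_basis (hw : IsSocleGenerator (R := R) w)
    (hP : ∀ l, (P l).asIdeal ≠ maximalIdeal R)
    (hQ : ∀ l, IsInjectiveHull R (R ⧸ (P l).asIdeal) (Q l))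
    (D : FrobHom p R E ≃ₗ[FrobRing p R] (⨁ _ : Γ, FrobMod p E) × (⨁ l, FrobMod p (Q l))) :
    Nonempty (Module.Basis Γ (FrobRing p (ResidueField R))
      (FrobHom p (ResidueField R) (ResidueField R))) := by
  classical
  let e : Γ → ⨁ _ : Γ, FrobMod p E := fun γ =>
    DirectSum.lof (FrobRing p R) Γ (fun _ => FrobMod p E) γ (toFrobMod p w)
  have hew : ∀ r ∈ maximalIdeal R, toFrobRing p r • toFrobMod p w = 0 := hw.smul_eq_zero
  -- The basis vectors correspond under `D` to the socle generators of the copies of `ᶠE`.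
  have hbex : ∀ γ, ∃ f, FrobHom.ofResidueField p hw.smul_eq_zero f = D.symm (e γ, 0) := fun γ =>
    hw.exists_ofResidueField_eq p fun r hr => by
      have h0 : toFrobRing p r • e γ = 0 := by rw [← map_smul, hew r hr, map_zero]
      rw [← map_smul]
      refine (congrArg D.symm (Prod.ext h0 (smul_zero _))).trans D.symm.map_zero
  choose b hb using hbex
  have hsum : ∀ (t : Finset Γ) (s : Γ → FrobRing p R),
      D (FrobHom.ofResidueField p hw.smul_eq_zero (∑ γ ∈ t, frobResidue p (s γ) • b γ)) =
        (∑ γ ∈ t, s γ • e γ, 0) := fun t s => by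
    rw [map_sum, map_sum]
    have : ∀ γ ∈ t, D (FrobHom.ofResidueField p hw.smul_eq_zero (frobResidue p (s γ) • b γ)) =
        (s γ • e γ, 0) := fun γ _ => by
      rw [FrobHom.ofResidueField_smul, hb, map_smul, D.apply_symm_apply]
      exact Prod.ext rfl (smul_zero _)
    rw [Finset.sum_congr rfl this]
    exact Prod.ext (by rw [Prod.fst_sum]) (by rw [Prod.snd_sum]; exact Finset.sum_const_zero)
  have happly : ∀ (t : Finset Γ) (s : Γ → FrobRing p R) (γ : Γ),
      (∑ δ ∈ t, s δ • e δ) γ = if γ ∈ t then s γ • toFrobMod p w else 0 := fun t s γ => by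
    have h1 : ∀ δ, (s δ • e δ) γ = if γ = δ then s δ • toFrobMod p w else 0 := fun δ => by
      rw [DirectSum.smul_apply]
      split_ifs with h
      · subst h
        exact congrArg (s γ • ·) (DirectSum.lof_apply _ _ _)
      · exact (congrArg (s δ • ·) (DirectSum.of_eq_of_ne _ _ _ h)).trans (smul_zero _)
    rw [DFinsupp.finsetSum_apply, Finset.sum_congr rfl fun δ _ => h1 δ, Finset.sum_ite_eq]
  refine ⟨Module.Basis.mk (v := b) ?_ fun f _ => ?_⟩
  · refine linearIndependent_iff'.2 fun t g hg γ hγ => ?_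
    choose s hs using fun δ => frobResidue_surjective p (g δ)
    simp only [← hs] at hg ⊢
    have h1 := hsum t s
    rw [hg, map_zero, map_zero] at h1
    have h2 := happly t s γ
    rw [show ∑ δ ∈ t, s δ • e δ = 0 from (congrArg Prod.fst h1).symm, if_pos hγ] at h2
    refine (residue_eq_zero_iff (R := R) _).2 ?_
    by_contra hu
    exact hw.ne_zero ((notMem_maximalIdeal.1 hu).smul_eq_zero.1 h2.symm)
  · set y := D (FrobHom.ofResidueField p hw.smul_eq_zero f) with hy
    have hkill : ∀ r ∈ maximalIdeal R, toFrobRing p r • y = 0 := fun r hr => by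
      rw [hy, ← map_smul, FrobHom.smul_ofResidueField p hw.smul_eq_zero f hr, map_zero]
    have hy2 : y.2 = 0 := directSum_frobMod_eq_zero p hP hQ _ (k := 1) fun r hr => by
      rw [pow_one] at hr
      exact congrArg Prod.snd (hkill r hr)
    have hy1 : ∀ γ, ∃ s : FrobRing p R, y.1 γ = s • toFrobMod p w := fun γ => by
      obtain ⟨r, hr⟩ := hw.exists_eq_smul (a := (toFrobMod p).symm (y.1 γ)) fun r hr =>
        DFunLike.congr_fun (congrArg Prod.fst (hkill r hr)) γ
      exact ⟨toFrobRing p r, hr⟩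
    choose s hs using hy1
    have hf : f = ∑ γ ∈ DFinsupp.support y.1, frobResidue p (s γ) • b γ := by
      apply FrobHom.ofResidueField_injective p hw.smul_eq_zero hw.ne_zero
      apply D.injective
      rw [hsum, ← hy]
      refine Prod.ext (DFinsupp.ext fun γ => ?_) hy2
      refine Eq.trans ?_ (happly _ s γ).symm
      split_ifs with h
      · exact hs γ
      · exact DFinsupp.notMem_support_iff.1 h
    rw [hf]
    exact Submodule.sum_mem _ fun γ _ => Submodule.smul_mem _ _ (Submodule.subset_span ⟨γ, rfl⟩)

-- Tower law for `K → ᶠK` and the `ᶠK`-module `Hom(ᶠK, K)`, whose restricted `K`-structure is the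
-- usual one on the dual.
omit [Fact p.Prime] in
open Cardinal in
lemma FrobHom.rank_mul_eq_rank_dual {K Γ : Type u} [Field K] [ExpChar K p]
    (b : Module.Basis Γ (FrobRing p K) (FrobHom p K K)) :
    Module.rank K (FrobRing p K) * #Γ = Module.rank K (FrobRing p K →ₗ[K] K) := by
  have : Nontrivial (FrobRing p K) := inferInstanceAs (Nontrivial K)
  let : Module K (FrobHom p K K) := inferInstanceAs (Module K (FrobRing p K →ₗ[K] K))
  have : IsScalarTower K (FrobRing p K) (FrobHom p K K) :=
    ⟨fun c l f => FrobHom.ext p fun t => by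
      change f (c • l * t) = c • f (l * t)
      rw [smul_mul_assoc]
      exact FrobHom.map_smul_eq p f c (l * t)⟩
  have := Module.Free.of_basis b
  rw [b.mk_eq_rank'', rank_mul_rank K (FrobRing p K) (FrobHom p K K)]
  rfl

theorem FrobHom.nonempty_and_finite_iff (hw : IsSocleGenerator (R := R) w)
    (hP : ∀ l, (P l).asIdeal ≠ maximalIdeal R)
    (hQ : ∀ l, IsInjectiveHull R (R ⧸ (P l).asIdeal) (Q l))
    (D : FrobHom p R E ≃ₗ[FrobRing p R] (⨁ _ : Γ, FrobMod p E) × (⨁ l, FrobMod p (Q l))) :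
    Nonempty Γ ∧ (Finite Γ ↔ Module.Finite (ResidueField R) (FrobRing p (ResidueField R))) ∧
      (Finite Γ → Nat.card Γ = 1) := by
  obtain ⟨b⟩ := FrobHom.nonempty_basis p hw hP hQ D
  have : Nontrivial (FrobRing p (ResidueField R)) := inferInstanceAs (Nontrivial (ResidueField R))
  exact Module.finite_iff_of_rank_mul_eq_rank_dual (FrobHom.rank_mul_eq_rank_dual p b)

end Socle

theorem mainTheorem5 {R : Type u} [CommRing R] [IsRegularLocalRing R]
    [IsAdicComplete (maximalIdeal R) R] (p : ℕ) [Fact p.Prime] [CharP R p]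
    (E : Type u) [AddCommGroup E] [Module R E] (hE : IsInjectiveHull R (ResidueField R) E) :
    -- (a), existence of the decomposition
    Module.Injective (FrobRing p R) (FrobHom p R E) ∧
    (∃ (Γ Λ : Type u) (P : Λ → PrimeSpectrum R) (Q : Λ → Type u)
      (_ : ∀ l, AddCommGroup (Q l)) (_ : ∀ l, Module R (Q l)),
      Nonempty Γ ∧ (∀ l, (P l).asIdeal ≠ maximalIdeal R) ∧
      (∀ l, IsInjectiveHull R (R ⧸ (P l).asIdeal) (Q l)) ∧
      Nonempty (FrobHom p R E ≃ₗ[FrobRing p R]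
        (⨁ _ : Γ, FrobMod p E) × (⨁ l, FrobMod p (Q l)))) ∧
    -- the remaining assertions, for every such decomposition `D`
    (∀ (Γ Λ : Type u) (P : Λ → PrimeSpectrum R) (Q : Λ → Type u)
      [∀ l, AddCommGroup (Q l)] [∀ l, Module R (Q l)],
      (∀ l, (P l).asIdeal ≠ maximalIdeal R) →
      (∀ l, IsInjectiveHull R (R ⧸ (P l).asIdeal) (Q l)) →
      ∀ D : FrobHom p R E ≃ₗ[FrobRing p R]
        (⨁ _ : Γ, FrobMod p E) × (⨁ l, FrobMod p (Q l)),
      -- (a)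
      Nonempty Γ ∧
      -- (b)
      (∃ Ψ : FrobHom p R R ≃ₗ[FrobRing p R] (E →ₗ[R] ⨁ _ : Γ, FrobMod p E),
        ∀ (φ : FrobHom p R R) (a : E),
          D (FrobHom.map p (LinearMap.toSpanSingleton R E a) φ) = (Ψ φ a, 0)) ∧
      Function.Injective (homComponents p R E Γ) ∧
      (∀ (d : ℕ) (x : Fin d → R), d = (maximalIdeal R).spanFinrank →
        Ideal.span (Set.range x) = maximalIdeal R →
        Nonempty (E ≃ₗ[R] InversePolynomials x) ∧
        ∀ θ : E ≃ₗ[R] InversePolynomials x,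
          ∃ Φ : (Γ → FrobRing p R) ≃ₗ[FrobRing p R] (Γ → (E →ₗ[R] FrobMod p E)),
            ∀ (r : Γ → FrobRing p R) (γ : Γ),
              Φ r γ = r γ • InversePolynomials.frobenius p x θ) ∧
      -- (c)
      (Finite Γ ↔ Module.Finite (ResidueField R) (FrobRing p (ResidueField R))) ∧
      (Finite Γ → Nat.card Γ = 1)) := by
  have hdec := fun (Γ Λ : Type u) (P : Λ → PrimeSpectrum R) (Q : Λ → Type u)
      [∀ l, AddCommGroup (Q l)] [∀ l, Module R (Q l)] hP hQ
      (D : FrobHom p R E ≃ₗ[FrobRing p R] (⨁ _ : Γ, FrobMod p E) × (⨁ l, FrobMod p (Q l))) =>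
    FrobHom.nonempty_and_finite_iff (P := P) p hE.exists_isSocleGenerator.choose_spec hP hQ D
  refine ⟨FrobHom.injective p hE.1, ?_, fun Γ Λ P Q _ _ hP hQ D => ?_⟩
  · obtain ⟨Γ, Λ, P, Q, _, _, hP, hQ, ⟨D⟩⟩ := FrobHom.exists_decomposition p hE
    exact ⟨Γ, Λ, P, Q, _, _, (hdec Γ Λ P Q hP hQ D).1, hP, hQ, ⟨D⟩⟩
  · obtain ⟨hne, hfin, hcard⟩ := hdec Γ Λ P Q hP hQ D
    refine ⟨hne, FrobHom.exists_linearEquiv_hom p hE hP hQ D, homComponents_injective p Γ,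
      fun d x hd hspan => ?_, hfin, hcard⟩
    have hx := IsRegularLocalRing.isPermutableRegular ((Fintype.card_fin d).trans hd) hspan
    exact ⟨InversePolynomials.nonempty_linearEquiv hspan hx hE,
      fun θ => InversePolynomials.exists_pi_linearEquiv p hspan hx θ Γ⟩
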